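/- Let $0<s<1$, $0<p<\infty$, $0<q\le\infty$, and let $S\subset\mathbb R^n$ be (Lebesgue) measurable. All functions below are measurable functions $u\colon S\to[-\infty,\infty]$, and all norms are allowed to take the value $\infty$ (for $p<1$ or $q<1$ they are quasi-norms). Write $\|u\|_{L^p(S)}=(\int_S|u|^p\,dx)^{1/p}$, $B(x,t)$ for the open Euclidean ball, and $S_h=\{x\in S: x+h\in S\}$ for $h\in\mathbb R^n$. A sequence $(g_k)_{k\in\mathbb Z}$ of measurable functions $g_k\colon S\to[0,\infty]$ is a fractional $s$-gradient of $u$, written $(g_k)\in\mathbb D^s(u)$, if there is a set $E\subset S$ of measure zero with $|u(x)-u(y)|\le|x-y|^s(g_k(x)+g_k(y))$ for all $k\in\mathbb Z$ and all $x,y\in S\setminus E$ with $2^{-k-1}\le|x-y|<2^{-k}$. The Hajłasz–Besov norm is $$\|u\|_{N^s_{p,q}(S)}=\|u\|_{L^p(S)}+\inf_{(g_k)\in\mathbb D^s(u)}\Big(\sum_{k\in\mathbb Z}\|g_k\|_{L^p(S)}^q\Big)^{1/q},$$ with $\sup_{k}\|g_k\|_{L^p(S)}$ in place of the sum if $q=\infty$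 (and $\inf\emptyset=\infty$). For $t>0$ put $$\omega(u,S,t)_p=\sup_{|h|\le t}\Big(\int_{S_h}|u(x+h)-u(x)|^p\,dx\Big)^{1/p},$$ $$E_p(u,S,t)=\Big(\frac1{|B(0,t)|}\int_{B(0,t)}\int_{S_h}|u(x+h)-u(x)|^p\,dx\,dh\Big)^{1/p},$$ $$\hat E_p(u,S,t)=\Big(\int_S\frac1{|B(x,t)|}\inf_{c\in\mathbb R}\int_{B(x,t)\cap S}|u(y)-c|^p\,dy\,dx\Big)^{1/p},$$ and let $\|u\|_{B^s_{p,q}(S)}$, $\|u\|_{\mathcal B^s_{p,q}(S)}$, $\|u\|_{\hat{\mathcal B}^s_{p,q}(S)}$ be $$\|u\|_{L^p(S)}+\Big(\int_0^1\big(t^{-s}F(t)\big)^q\,\frac{dt}t\Big)^{1/q}\qquad\Big(\text{resp. }\|u\|_{L^p(S)}+\sup_{0<t<1}t^{-s}F(t)\text{ if }q=\infty\Big)$$ with $F(t)=\omega(u,S,t)_p$, $F(t)=E_p(u,S,t)$ and $F(t)=\hat E_p(u,S,t)$, respectively. The spaces $N^s_{p,q}(S)$, $B^s_{p,q}(S)$,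 $\mathcal B^s_{p,q}(S)$, $\hat{\mathcal B}^s_{p,q}(S)$ consist of the measurable functions on $S$ for which the corresponding norm is finite. **Theorem.** (1) There is a constant $C>0$, depending only on $n,s,p,q$, such that for every measurable set $S\subset\mathbb R^n$ $$N^s_{p,q}(S)\subset B^s_{p,q}(S)\subset\mathcal B^s_{p,q}(S)\subset\hat{\mathcal B}^s_{p,q}(S)$$ and, for every measurable $u$ on $S$, $$\|u\|_{\hat{\mathcal B}^s_{p,q}(S)}\le\|u\|_{\mathcal B^s_{p,q}(S)}\le\|u\|_{B^s_{p,q}(S)}\le C\|u\|_{N^s_{p,q}(S)}.$$ (2) If $S$ is measurable and satisfies the measure density condition, that is, there is $c_m>0$ with $|S\cap B(x,r)|\ge c_m|B(x,r)|$ for all $x\in S$ and $0<r\le1$, then $$N^s_{p,q}(S)=B^s_{p,q}(S)=\mathcal B^s_{p,q}(S)=\hat{\mathcal B}^s_{p,q}(S)$$ with equivalent norms: in addition to the inequalities in (1), $\|u\|_{N^s_{p,q}(S)}\le C\|u\|_{\hat{\mathcal B}^s_{p,q}(S)}$ for every measurable $u$ on $S$, where $C$ depends only on $n,s,p,q$ and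 $c_m$. -/

import Mathlib

open MeasureTheory Set
open scoped ENNReal

noncomputable section

namespace BesovSubset

/-- `ℝⁿ` with the Euclidean norm. -/
abbrev Rn (n : ℕ) : Type := EuclideanSpace ℝ (Fin n)

/-- `u` is an extended real valued (Lebesgue) measurable function on `S`. Functions on `S` are
represented by functions on `ℝⁿ` of which only the values on `S` are ever used. -/
def LebesgueMeasurableOn {n : ℕ} (S : Set (Rn n)) (u : Rn n → EReal) : Prop :=
  AEMeasurable u (volume.restrict S)

/-- `|a - b| ∈ [0, ∞]`. For finite `a, b` this is the usual distance. The undefined differences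
`∞ - ∞` get the value `∞`; for functions that are finite a.e. they only occur on null sets. -/
def absDiff (a b : EReal) : ℝ≥0∞ := (a - b).abs

/-- The measure density condition with constant `c`. -/
def MeasureDensity {n : ℕ} (c : ℝ) (S : Set (Rn n)) : Prop :=
  ∀ x ∈ S, ∀ r : ℝ, 0 < r → r ≤ 1 →
    ENNReal.ofReal c * volume (Metric.ball x r) ≤ volume (S ∩ Metric.ball x r)

/-- `‖u‖_{L^p(S)}`, `0 < p < ∞`, with value `∞` if `u` is not in `L^p(S)`. -/
def normLp {n : ℕ} (p : ℝ) (S : Set (Rn n)) (u : Rn n → EReal) : ℝ≥0∞ :=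
  (∫⁻ x in S, (u x).abs ^ p) ^ (1 / p)

/-! ### Hajłasz–Besov spaces -/

/-- `(g_k)_{k ∈ ℤ}` is a fractional `s`-gradient of `u` in `S`. -/
def IsFracGradient {n : ℕ} (s : ℝ) (S : Set (Rn n)) (u : Rn n → EReal)
    (g : ℤ → Rn n → ℝ≥0∞) : Prop :=
  (∀ k, AEMeasurable (g k) (volume.restrict S)) ∧
  ∃ E : Set (Rn n), E ⊆ S ∧ volume E = 0 ∧
    ∀ k : ℤ, ∀ x ∈ S \ E, ∀ y ∈ S \ E,
      (2 : ℝ) ^ (-k - 1) ≤ dist x y → dist x y < (2 : ℝ) ^ (-k) →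
        absDiff (u x) (u y) ≤ ENNReal.ofReal (dist x y ^ s) * (g k x + g k y)

/-- The `l^q` norm of a nonnegative sequence over `ℤ`, `0 < q ≤ ∞`. -/
def seqNorm (q : ℝ≥0∞) (a : ℤ → ℝ≥0∞) : ℝ≥0∞ :=
  if q = ∞ then ⨆ k, a k else (∑' k, a k ^ q.toReal) ^ (1 / q.toReal)

/-- `‖(g_k)‖_{l^q(L^p(S))}`. -/
def gradNorm {n : ℕ} (p : ℝ) (q : ℝ≥0∞) (S : Set (Rn n)) (g : ℤ → Rn n → ℝ≥0∞) : ℝ≥0∞ :=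
  seqNorm q (fun k => (∫⁻ x in S, g k x ^ p) ^ (1 / p))

/-- The norm of the Hajłasz–Besov space `N^s_{p,q}(S)`
(an infimum over the empty set is `∞`). -/
def normN {n : ℕ} (s p : ℝ) (q : ℝ≥0∞) (S : Set (Rn n)) (u : Rn n → EReal) : ℝ≥0∞ :=
  normLp p S u +
    ⨅ (g : ℤ → Rn n → ℝ≥0∞) (_ : IsFracGradient s S u g), gradNorm p q S g

/-! ### Besov spaces defined by moduli of smoothness -/

/-- `S_h = S ∩ (S - h)`, the set of `x ∈ S` with `x + h ∈ S`. -/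
def shiftInter {n : ℕ} (S : Set (Rn n)) (h : Rn n) : Set (Rn n) :=
  {x | x ∈ S ∧ x + h ∈ S}

/-- The `L^p`-modulus of smoothness `ω(u,S,t)_p`. -/
def omega {n : ℕ} (p : ℝ) (S : Set (Rn n)) (u : Rn n → EReal) (t : ℝ) : ℝ≥0∞ :=
  ⨆ (h : Rn n) (_ : ‖h‖ ≤ t),
    (∫⁻ x in shiftInter S h, absDiff (u (x + h)) (u x) ^ p) ^ (1 / p)

/-- The averaged modulus of smoothness `E_p(u,S,t)`. -/
def avgModulus {n : ℕ} (p : ℝ) (S : Set (Rn n)) (u : Rn n → EReal) (t : ℝ) : ℝ≥0∞ :=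
  ((volume (Metric.ball (0 : Rn n) t))⁻¹ *
    ∫⁻ h in Metric.ball (0 : Rn n) t,
      ∫⁻ x in shiftInter S h, absDiff (u (x + h)) (u x) ^ p) ^ (1 / p)

/-- The local approximation by constants, `Ê_p(u,S,t)`. -/
def hatModulus {n : ℕ} (p : ℝ) (S : Set (Rn n)) (u : Rn n → EReal) (t : ℝ) : ℝ≥0∞ :=
  (∫⁻ x in S, (volume (Metric.ball x t))⁻¹ *
    ⨅ c : ℝ, ∫⁻ y in Metric.ball x t ∩ S, absDiff (u y) (c : EReal) ^ p) ^ (1 / p)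

/-- `(∫₀¹ (t^{-s} F(t))^q dt/t)^{1/q}` if `q < ∞`, and `sup_{0<t<1} t^{-s} F(t)` if `q = ∞`. -/
def scaleNorm (s : ℝ) (q : ℝ≥0∞) (F : ℝ → ℝ≥0∞) : ℝ≥0∞ :=
  if q = ∞ then ⨆ t ∈ Ioo (0 : ℝ) 1, ENNReal.ofReal (t ^ (-s)) * F t
  else (∫⁻ t in Ioo (0 : ℝ) 1,
    (ENNReal.ofReal (t ^ (-s)) * F t) ^ q.toReal * ENNReal.ofReal (1 / t)) ^ (1 / q.toReal)

/-- The norm of `B^s_{p,q}(S)`. -/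
def normB {n : ℕ} (s p : ℝ) (q : ℝ≥0∞) (S : Set (Rn n)) (u : Rn n → EReal) : ℝ≥0∞ :=
  normLp p S u + scaleNorm s q (omega p S u)

/-- The norm of `𝓑^s_{p,q}(S)`. -/
def normBavg {n : ℕ} (s p : ℝ) (q : ℝ≥0∞) (S : Set (Rn n)) (u : Rn n → EReal) : ℝ≥0∞ :=
  normLp p S u + scaleNorm s q (avgModulus p S u)

/-- The norm of `𝓑̂^s_{p,q}(S)`. -/
def normBhat {n : ℕ} (s p : ℝ) (q : ℝ≥0∞) (S : Set (Rn n)) (u : Rn n → EReal) : ℝ≥0∞ :=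
  normLp p S u + scaleNorm s q (hatModulus p S u)

/-! ### The spaces -/

/-- The Hajłasz–Besov space `N^s_{p,q}(S)`. -/
def spaceN {n : ℕ} (s p : ℝ) (q : ℝ≥0∞) (S : Set (Rn n)) : Set (Rn n → EReal) :=
  {u | LebesgueMeasurableOn S u ∧ normN s p q S u < ∞}

/-- The Besov space `B^s_{p,q}(S)`. -/
def spaceB {n : ℕ} (s p : ℝ) (q : ℝ≥0∞) (S : Set (Rn n)) : Set (Rn n → EReal) :=
  {u | LebesgueMeasurableOn S u ∧ normB s p q S u < ∞}

/-- The Besov space `𝓑^s_{p,q}(S)`. -/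
def spaceBavg {n : ℕ} (s p : ℝ) (q : ℝ≥0∞) (S : Set (Rn n)) : Set (Rn n → EReal) :=
  {u | LebesgueMeasurableOn S u ∧ normBavg s p q S u < ∞}

/-- The Besov space `𝓑̂^s_{p,q}(S)`. -/
def spaceBhat {n : ℕ} (s p : ℝ) (q : ℝ≥0∞) (S : Set (Rn n)) : Set (Rn n → EReal) :=
  {u | LebesgueMeasurableOn S u ∧ normBhat s p q S u < ∞}

end BesovSubset

end

/-!
If `‖u‖_{L^p(S)} = ∞`, all four norms are infinite. Otherwise `u` is finite almost everywhere, and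
none of the norms changes when `S` is replaced by a Borel subset of full measure on which `u` equals
a Borel function `v` with real values (`exists_real_representative`).

The chain `𝓑̂ ≤ 𝓑 ≤ B` is a pointwise comparison of moduli: `c = u x` is a competitor in the local
approximation (`hatModulus_le_avgModulus`), and an average is at most a supremum
(`avgModulus_le_omega`). For `B ≤ C N`, a translation by `h` with `2^{-j-1} ≤ |h| < 2^{-j}` costs at
most a multiple of `2^{-js} ‖g_j‖_p` (`exists_lintegral_shiftInter_le`), so that for
`t ∼ 2^{-k}` the quantity `t^{-s} ω(u, S, t)_p` is bounded by a multiple of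
`sup_{i ≥ 0} 2^{-is} ‖g_{k+i}‖_p`. A discrete Hardy inequality (`exists_seqNorm_iSup_le`) concludes.

For `N ≤ C 𝓑̂` under measure density, the gradient is written down explicitly. At coarse scales,
`k ≤ 1`, it is `2^{(k+1)s} |v|`. At fine scales it is a multiple of
`2^{ks} sup_{i ≥ 0} 2^{is/2} osc(x, 2^{1-k-i})`, where `osc(x, r)^p` is the normalized infimum over
constants `c` of `∫_{B(x,r) ∩ S} |v - c|^p` (`localOsc`, `maxOsc`). If that supremum is less than
`M`, there are constants `c_i` approximating `v` on `B(x, 2^{1-k-i})` with error `M 2^{-is/2}`. By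
Chebyshev's inequality and measure density two consecutive approximations are both good at a common
point, which gives `|c_i - c_{i+1}| ≲ M 2^{-is/2}`; by Lebesgue's density theorem `c_i → v x` at
almost every `x`. Hence `|v x - c_0| ≲ M`, and comparing `c_0` for two points `x` and `y` with
`|x - y| < 2^{-k}` in the same way gives the gradient inequality (`enorm_sub_le_maxOsc`). Working with
Chebyshev's inequality rather than with averages of `v` is what allows `p < 1`. Bounding sums by
suprema with half of the geometric decay given away (`exists_tsum_rpow_le_iSup`) makes the norm
estimate uniform in `p` and `q`, and it again ends with the Hardy inequality
(`exists_gradNorm_gradCore_le`).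
-/

noncomputable section

namespace BesovSubset

/-! ### Sums and suprema in `[0, ∞]` -/

theorem add_rpow_le {r : ℝ} (hr : 0 ≤ r) (a b : ℝ≥0∞) :
    (a + b) ^ r ≤ 2 ^ r * (a ^ r + b ^ r) := by
  have h : a + b ≤ 2 * max a b := by
    rw [two_mul]; exact add_le_add (le_max_left _ _) (le_max_right _ _)
  calc (a + b) ^ r ≤ (2 * max a b) ^ r := ENNReal.rpow_le_rpow h hr
    _ = 2 ^ r * (max a b) ^ r := ENNReal.mul_rpow_of_nonneg _ _ hr
    _ ≤ 2 ^ r * (a ^ r + b ^ r) := by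
        gcongr
        rcases max_choice a b with h | h <;> rw [h]
        exacts [le_self_add, le_add_self]

theorem rpow_inv_rpow {r : ℝ} (hr : 0 < r) (a : ℝ≥0∞) : (a ^ (1 / r)) ^ r = a := by
  rw [← ENNReal.rpow_mul, one_div_mul_cancel hr.ne', ENNReal.rpow_one]

theorem rpow_rpow_inv' {r : ℝ} (hr : 0 < r) (a : ℝ≥0∞) : (a ^ r) ^ (1 / r) = a := by
  rw [← ENNReal.rpow_mul, mul_one_div_cancel hr.ne', ENNReal.rpow_one]

theorem iSup_rpow {ι : Sort*} {r : ℝ} (hr : 0 < r) (f : ι → ℝ≥0∞) :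
    (⨆ i, f i) ^ r = ⨆ i, f i ^ r :=
  (ENNReal.orderIsoRpow r hr).map_iSup f

theorem iSup_le_tsum {ι : Type*} (f : ι → ℝ≥0∞) : ⨆ i, f i ≤ ∑' i, f i :=
  iSup_le fun i => ENNReal.le_tsum i

theorem inv_one_sub_ne_top {ρ : ℝ≥0∞} (h : ρ < 1) : (1 - ρ)⁻¹ ≠ ∞ :=
  ENNReal.inv_ne_top.2 (tsub_pos_of_lt h).ne'

/-- Splitting a weight `ρ ^ (2 * i)` into two factors bounds an `ℓ^r` sum by a supremum, for every
`r > 0`; this replaces Minkowski's and Hölder's inequalities and needs no case distinction at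
`r = 1`. -/
theorem exists_tsum_rpow_le_iSup {ρ : ℝ≥0∞} (hρ : ρ < 1) {r : ℝ} (hr : 0 < r) :
    ∃ K : ℝ≥0∞, K ≠ ∞ ∧ ∀ c : ℕ → ℝ≥0∞,
      (∑' i, (ρ ^ i * ρ ^ i * c i) ^ r) ^ (1 / r) ≤ K * ⨆ i, ρ ^ i * c i := by
  have hρr : ρ ^ r < 1 := ENNReal.rpow_lt_one hρ hr
  refine ⟨((1 - ρ ^ r)⁻¹) ^ (1 / r), ENNReal.rpow_ne_top_of_nonneg (by positivity)
    (inv_one_sub_ne_top hρr), fun c => ?_⟩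
  set G := ⨆ i, ρ ^ i * c i
  have h : ∑' i, (ρ ^ i * ρ ^ i * c i) ^ r ≤ (1 - ρ ^ r)⁻¹ * G ^ r := by
    rw [← ENNReal.tsum_geometric, ← ENNReal.tsum_mul_right]
    refine ENNReal.tsum_le_tsum fun i => ?_
    rw [mul_assoc, ENNReal.mul_rpow_of_nonneg _ _ hr.le, ← ENNReal.rpow_natCast, ← ENNReal.rpow_mul,
      ← ENNReal.rpow_natCast, ← ENNReal.rpow_mul, mul_comm r]
    gcongr
    rw [ENNReal.rpow_natCast]
    exact le_iSup (fun i => ρ ^ i * c i) i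
  calc _ ≤ ((1 - ρ ^ r)⁻¹ * G ^ r) ^ (1 / r) := ENNReal.rpow_le_rpow h (by positivity)
    _ = _ := by rw [ENNReal.mul_rpow_of_nonneg _ _ (by positivity), rpow_rpow_inv' hr]

theorem seqNorm_mono {q : ℝ≥0∞} {a b : ℤ → ℝ≥0∞} (h : ∀ k, a k ≤ b k) :
    seqNorm q a ≤ seqNorm q b := by
  unfold seqNorm
  split_ifs
  · exact iSup_mono h
  · gcongr with k
    exact h k

theorem seqNorm_shift (q : ℝ≥0∞) (a : ℤ → ℝ≥0∞) (m : ℤ) :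
    seqNorm q (fun k => a (k + m)) = seqNorm q a := by
  have h1 : ⨆ k, a (k + m) = ⨆ k, a k := (Equiv.addRight m).iSup_congr fun _ => rfl
  have h2 : ∑' k, a (k + m) ^ q.toReal = ∑' k, a k ^ q.toReal :=
    (Equiv.addRight m).tsum_eq fun k => a k ^ q.toReal
  simp only [seqNorm, h1, h2]

theorem seqNorm_const_mul (q : ℝ≥0∞) (hq : 0 < q) (c : ℝ≥0∞) (a : ℤ → ℝ≥0∞) :
    seqNorm q (fun k => c * a k) = c * seqNorm q a := by
  unfold seqNorm
  split_ifs with h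
  · rw [ENNReal.mul_iSup]
  · have hq' : 0 < q.toReal := ENNReal.toReal_pos hq.ne' h
    simp_rw [ENNReal.mul_rpow_of_nonneg _ _ hq'.le]
    rw [ENNReal.tsum_mul_left, ENNReal.mul_rpow_of_nonneg _ _ (by positivity), rpow_rpow_inv' hq']

theorem exists_seqNorm_add_le (q : ℝ≥0∞) :
    ∃ K : ℝ≥0∞, K ≠ ∞ ∧ ∀ a b : ℤ → ℝ≥0∞,
      seqNorm q (fun k => a k + b k) ≤ K * (seqNorm q a + seqNorm q b) := by
  unfold seqNorm
  split_ifs with h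
  · refine ⟨1, ENNReal.one_ne_top, fun a b => ?_⟩
    rw [one_mul]
    exact iSup_le fun k => add_le_add (le_iSup a k) (le_iSup b k)
  · set r := q.toReal
    have hr : 0 ≤ r := ENNReal.toReal_nonneg
    refine ⟨((2 : ℝ≥0∞) ^ r) ^ (1 / r) * 2 ^ (1 / r), by finiteness, fun a b => ?_⟩
    calc (∑' k, (a k + b k) ^ r) ^ (1 / r)
        ≤ (2 ^ r * (∑' k, a k ^ r + ∑' k, b k ^ r)) ^ (1 / r) := by
          gcongr
          rw [← ENNReal.tsum_add, ← ENNReal.tsum_mul_left]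
          exact ENNReal.tsum_le_tsum fun k => add_rpow_le hr _ _
      _ = ((2 : ℝ≥0∞) ^ r) ^ (1 / r) * (∑' k, a k ^ r + ∑' k, b k ^ r) ^ (1 / r) :=
          ENNReal.mul_rpow_of_nonneg _ _ (by positivity)
      _ ≤ _ := by
          rw [mul_assoc]
          gcongr
          exact add_rpow_le (by positivity) _ _

theorem seqNorm_single {q : ℝ≥0∞} (hq : 0 < q) (m : ℤ) (A : ℝ≥0∞) :
    seqNorm q (fun k => if k = m then A else 0) = A := by
  unfold seqNorm
  split_ifs with h
  · refine le_antisymm (iSup_le fun k => ?_) (le_iSup_of_le m (by simp))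
    dsimp only
    split_ifs <;> simp
  · have hq' : 0 < q.toReal := ENNReal.toReal_pos hq.ne' h
    rw [tsum_eq_single m (fun k hk => by simp [hk, hq'])]
    simp only [if_true, rpow_rpow_inv' hq']

/-- The discrete Hardy inequality, in the form with a supremum over the finer scales. -/
theorem exists_seqNorm_iSup_le {ρ q : ℝ≥0∞} (hρ : ρ < 1) (hq : 0 < q) :
    ∃ K : ℝ≥0∞, K ≠ ∞ ∧ ∀ b : ℤ → ℝ≥0∞,
      seqNorm q (fun k => ⨆ i : ℕ, ρ ^ i * b (k + i)) ≤ K * seqNorm q b := by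
  unfold seqNorm
  split_ifs with h
  · refine ⟨1, ENNReal.one_ne_top, fun b => iSup_le fun k => iSup_le fun i => ?_⟩
    gcongr
    · exact pow_le_one₀ zero_le hρ.le
    · exact le_iSup b _
  · set r := q.toReal
    have hr : 0 < r := ENNReal.toReal_pos hq.ne' h
    have hρr : ρ ^ r < 1 := ENNReal.rpow_lt_one hρ hr
    refine ⟨((1 - ρ ^ r)⁻¹) ^ (1 / r), ENNReal.rpow_ne_top_of_nonneg (by positivity)
      (inv_one_sub_ne_top hρr), fun b => ?_⟩
    have key : ∑' k : ℤ, (⨆ i : ℕ, ρ ^ i * b (k + i)) ^ r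
        ≤ (1 - ρ ^ r)⁻¹ * ∑' k, b k ^ r := by
      calc ∑' k : ℤ, (⨆ i : ℕ, ρ ^ i * b (k + i)) ^ r
          ≤ ∑' k : ℤ, ∑' i : ℕ, (ρ ^ r) ^ i * b (k + i) ^ r := by
            refine ENNReal.tsum_le_tsum fun k => ?_
            rw [iSup_rpow hr]
            refine (iSup_le_tsum _).trans (ENNReal.tsum_le_tsum fun i => ?_)
            rw [ENNReal.mul_rpow_of_nonneg _ _ hr.le, ← ENNReal.rpow_natCast, ← ENNReal.rpow_mul,
              ← ENNReal.rpow_natCast, ← ENNReal.rpow_mul, mul_comm r]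
        _ = ∑' i : ℕ, ∑' k : ℤ, (ρ ^ r) ^ i * b (k + i) ^ r := ENNReal.tsum_comm
        _ = ∑' i : ℕ, (ρ ^ r) ^ i * ∑' k : ℤ, b k ^ r := by
            congr with i
            rw [ENNReal.tsum_mul_left]
            congr 1
            exact (Equiv.addRight (i : ℤ)).tsum_eq fun k => b k ^ r
        _ = (1 - ρ ^ r)⁻¹ * ∑' k, b k ^ r := by
            rw [ENNReal.tsum_mul_right, ENNReal.tsum_geometric]
    calc _ ≤ ((1 - ρ ^ r)⁻¹ * ∑' k, b k ^ r) ^ (1 / r) :=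
          ENNReal.rpow_le_rpow key (by positivity)
      _ = _ := ENNReal.mul_rpow_of_nonneg _ _ (by positivity)

/-! ### Dyadic decomposition of the scale integral -/

/-- The dyadic interval `[2^{-k-1}, 2^{-k})`. -/
def dyadicIco (k : ℤ) : Set ℝ := Ico ((2 : ℝ) ^ (-k - 1)) ((2 : ℝ) ^ (-k))

theorem exists_mem_dyadicIco {t : ℝ} (ht : 0 < t) : ∃ k : ℤ, t ∈ dyadicIco k := by
  obtain ⟨m, hm⟩ := exists_mem_Ico_zpow ht (one_lt_two : (1 : ℝ) < 2)
  refine ⟨-m - 1, ?_⟩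
  have h : -(-m - 1) = m + 1 := by ring
  rw [dyadicIco, h, add_sub_cancel_right]
  exact hm

theorem pos_of_mem_dyadicIco {t : ℝ} {k : ℤ} (ht : t ∈ dyadicIco k) : 0 < t :=
  lt_of_lt_of_le (by positivity) ht.1

theorem le_of_mem_dyadicIco_of_le {t r : ℝ} {k j : ℤ} (ht : t ∈ dyadicIco k) (hr : r ∈ dyadicIco j)
    (h : r ≤ t) : k ≤ j := by
  have := (zpow_lt_zpow_iff_right₀ (one_lt_two : (1 : ℝ) < 2)).1
    ((hr.1.trans h).trans_lt ht.2)
  omega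

theorem dyadicIco_subset_Ioo {k : ℤ} (hk : 0 ≤ k) : dyadicIco k ⊆ Ioo 0 1 := fun _ ht =>
  ⟨pos_of_mem_dyadicIco ht, ht.2.trans_le (zpow_le_one_of_nonpos₀ one_le_two (by omega))⟩

theorem pairwise_disjoint_dyadicIco : Pairwise (Function.onFun Disjoint dyadicIco) := by
  intro j k hjk
  refine Set.disjoint_left.2 fun t hj hk => hjk ?_
  exact le_antisymm (le_of_mem_dyadicIco_of_le hj hk le_rfl)
    (le_of_mem_dyadicIco_of_le hk hj le_rfl)

theorem volume_dyadicIco (k : ℤ) :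
    volume (dyadicIco k) = ENNReal.ofReal ((2 : ℝ) ^ (-k - 1)) := by
  rw [dyadicIco, Real.volume_Ico]
  congr 1
  rw [zpow_sub_one₀ two_ne_zero]
  ring

theorem scaleNorm_mono {s : ℝ} {q : ℝ≥0∞} {F G : ℝ → ℝ≥0∞}
    (h : ∀ t ∈ Ioo (0 : ℝ) 1, F t ≤ G t) : scaleNorm s q F ≤ scaleNorm s q G := by
  unfold scaleNorm
  split_ifs
  · exact iSup₂_mono fun t ht => mul_le_mul_right (h t ht) _
  · refine ENNReal.rpow_le_rpow (setLIntegral_mono' measurableSet_Ioo fun t ht => ?_)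
      (by positivity)
    gcongr
    exact h t ht

/-- Each dyadic interval has `dt / t`-measure at most one. -/
theorem scaleNorm_le_seqNorm {s : ℝ} {q : ℝ≥0∞} {F : ℝ → ℝ≥0∞} {b : ℤ → ℝ≥0∞}
    (h : ∀ k, ∀ t ∈ dyadicIco k, ENNReal.ofReal (t ^ (-s)) * F t ≤ b k) :
    scaleNorm s q F ≤ seqNorm q b := by
  unfold scaleNorm seqNorm
  split_ifs with hq
  · refine iSup₂_le fun t ht => ?_
    obtain ⟨k, hk⟩ := exists_mem_dyadicIco ht.1
    exact (h k t hk).trans (le_iSup b k)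
  · refine ENNReal.rpow_le_rpow ?_ (by positivity)
    calc _ ≤ ∫⁻ t in ⋃ k, dyadicIco k,
          (ENNReal.ofReal (t ^ (-s)) * F t) ^ q.toReal * ENNReal.ofReal (1 / t) :=
          lintegral_mono_set fun t ht => mem_iUnion.2 (exists_mem_dyadicIco ht.1)
      _ ≤ ∑' k, ∫⁻ t in dyadicIco k,
          (ENNReal.ofReal (t ^ (-s)) * F t) ^ q.toReal * ENNReal.ofReal (1 / t) :=
          lintegral_iUnion_le _ _
      _ ≤ ∑' k, b k ^ q.toReal := by
        refine ENNReal.tsum_le_tsum fun k => ?_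
        calc _ ≤ ∫⁻ t in dyadicIco k,
              b k ^ q.toReal * ENNReal.ofReal (((2 : ℝ) ^ (-k - 1))⁻¹) := by
              refine setLIntegral_mono' measurableSet_Ico fun t ht => ?_
              gcongr
              · exact h k t ht
              · rw [one_div]
                exact inv_anti₀ (by positivity) ht.1
          _ = b k ^ q.toReal := by
              rw [setLIntegral_const, volume_dyadicIco, mul_assoc,
                ← ENNReal.ofReal_mul (by positivity), inv_mul_cancel₀ (by positivity),
                ENNReal.ofReal_one, mul_one]

/-- Each dyadic interval has `dt / t`-measure at least `1 / 2`, and those with `k ≥ 0` are disjoint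
subsets of `(0, 1)`. No measurability of `F` is needed. -/
theorem exists_seqNorm_le_scaleNorm {q : ℝ≥0∞} (hq : 0 < q) :
    ∃ K : ℝ≥0∞, K ≠ ∞ ∧ ∀ (s : ℝ) (F : ℝ → ℝ≥0∞) (b : ℤ → ℝ≥0∞), (∀ k < 0, b k = 0) →
      (∀ k, 0 ≤ k → ∀ t ∈ dyadicIco k, b k ≤ ENNReal.ofReal (t ^ (-s)) * F t) →
      seqNorm q b ≤ K * scaleNorm s q F := by
  unfold scaleNorm seqNorm
  split_ifs with hq'
  · refine ⟨1, ENNReal.one_ne_top, fun s F b h0 h => iSup_le fun k => ?_⟩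
    rcases lt_or_ge k 0 with hk | hk
    · simp [h0 k hk]
    have ht : (2 : ℝ) ^ (-k - 1) ∈ dyadicIco k :=
      ⟨le_rfl, zpow_lt_zpow_right₀ one_lt_two (by omega)⟩
    rw [one_mul]
    exact (h k hk _ ht).trans (le_iSup₂ (f := fun (t : ℝ) (_ : t ∈ Ioo (0 : ℝ) 1) =>
      ENNReal.ofReal (t ^ (-s)) * F t) _ (dyadicIco_subset_Ioo hk ht))
  · have hr : 0 < q.toReal := ENNReal.toReal_pos hq.ne' hq'
    refine ⟨2 ^ (1 / q.toReal), by finiteness, fun s F b h0 h => ?_⟩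
    rw [← ENNReal.mul_rpow_of_nonneg _ _ (by positivity)]
    refine ENNReal.rpow_le_rpow ?_ (by positivity)
    set f : ℝ → ℝ≥0∞ :=
      fun t => (ENNReal.ofReal (t ^ (-s)) * F t) ^ q.toReal * ENNReal.ofReal (1 / t)
    have hterm : ∀ k, b k ^ q.toReal ≤ 2 * ∫⁻ t in dyadicIco k ∩ Ioo 0 1, f t := by
      intro k
      rcases lt_or_ge k 0 with hk | hk
      · simp [h0 k hk, hr]
      rw [inter_eq_left.2 (dyadicIco_subset_Ioo hk)]
      calc b k ^ q.toReal
          = 2 * ∫⁻ t in dyadicIco k, b k ^ q.toReal * ENNReal.ofReal (((2 : ℝ) ^ (-k))⁻¹) := by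
            rw [setLIntegral_const, volume_dyadicIco, mul_assoc,
                ← ENNReal.ofReal_mul (by positivity), zpow_sub_one₀ two_ne_zero,
                inv_mul_cancel_left₀ (by positivity), mul_left_comm,
                ENNReal.ofReal_inv_of_pos two_pos, ENNReal.ofReal_ofNat,
                ENNReal.mul_inv_cancel two_ne_zero ENNReal.ofNat_ne_top, mul_one]
        _ ≤ 2 * ∫⁻ t in dyadicIco k, f t := by
            refine mul_le_mul_right (setLIntegral_mono' measurableSet_Ico fun t ht => ?_) _
            refine mul_le_mul' (ENNReal.rpow_le_rpow (h k hk t ht) hr.le) ?_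
            rw [one_div]
            exact ENNReal.ofReal_le_ofReal (inv_anti₀ (pos_of_mem_dyadicIco ht) ht.2.le)
    calc ∑' k, b k ^ q.toReal ≤ ∑' k, 2 * ∫⁻ t in dyadicIco k ∩ Ioo 0 1, f t :=
          ENNReal.tsum_le_tsum hterm
      _ = 2 * ∫⁻ t in ⋃ k, dyadicIco k ∩ Ioo 0 1, f t := by
          rw [ENNReal.tsum_mul_left, lintegral_iUnion]
          · exact fun k => measurableSet_Ico.inter measurableSet_Ioo
          · exact fun j k hjk => (pairwise_disjoint_dyadicIco hjk).mono inter_subset_left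
              inter_subset_left
      _ ≤ 2 * ∫⁻ t in Ioo 0 1, f t :=
          mul_le_mul_right (lintegral_mono_set (iUnion_subset fun k => inter_subset_right)) _

/-! ### Comparison of the moduli -/

theorem absDiff_coe (a b : ℝ) : absDiff (a : EReal) (b : EReal) = ‖a - b‖ₑ := by
  rw [absDiff, ← EReal.coe_sub, Real.enorm_eq_ofReal_abs]
  rfl

theorem measurableSet_shiftInter {n : ℕ} {S : Set (Rn n)} (hS : MeasurableSet S) (h : Rn n) :
    MeasurableSet (shiftInter S h) :=
  hS.inter (measurable_add_const h hS)

/-- The value `c = u x` is a competitor in the local approximation on `B(x, t)`. -/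
theorem hatModulus_le_avgModulus {n : ℕ} {p : ℝ} (hp : 0 < p) {S : Set (Rn n)}
    (hS : MeasurableSet S) {v : Rn n → ℝ} (hv : Measurable v) {t : ℝ} (ht : 0 < t) :
    hatModulus p S (fun x => (v x : EReal)) t ≤ avgModulus p S (fun x => (v x : EReal)) t := by
  unfold hatModulus avgModulus
  simp only [absDiff_coe]
  refine ENNReal.rpow_le_rpow ?_ (by positivity)
  set B : Set (Rn n) := Metric.ball 0 t
  have hB : (volume B)⁻¹ ≠ ∞ := ENNReal.inv_ne_top.2 (Metric.measure_ball_pos _ _ ht).ne'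
  set A : Set (Rn n × Rn n) := {z | z.1 ∈ S ∧ z.2 ∈ B ∧ z.1 + z.2 ∈ S}
  have hA : MeasurableSet A :=
    (measurable_fst hS).inter ((measurable_snd measurableSet_ball).inter
      ((measurable_fst.add measurable_snd) hS))
  set F : Rn n × Rn n → ℝ≥0∞ := A.indicator fun z => ‖v (z.1 + z.2) - v z.1‖ₑ ^ p
  have hF : Measurable F := by
    refine Measurable.indicator ?_ hA
    fun_prop
  have hF1 (x h : Rn n) (H : (x, h) ∈ A) : F (x, h) = ‖v (x + h) - v x‖ₑ ^ p :=
    indicator_of_mem H _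
  have hF0 (x h : Rn n) (H : (x, h) ∉ A) : F (x, h) = 0 := indicator_of_notMem H _
  calc ∫⁻ x in S, (volume (Metric.ball x t))⁻¹ *
        ⨅ c : ℝ, ∫⁻ y in Metric.ball x t ∩ S, ‖v y - c‖ₑ ^ p
      ≤ ∫⁻ x in S, (volume B)⁻¹ * ∫⁻ h, F (x, h) := by
        refine setLIntegral_mono' hS fun x hx => ?_
        rw [Measure.addHaar_ball_center]
        gcongr
        refine (iInf_le _ (v x)).trans_eq ?_
        rw [← lintegral_indicator (measurableSet_ball.inter hS), ← lintegral_add_left_eq_self _ x]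
        congr with h
        by_cases hh : h ∈ B ∧ x + h ∈ S
        · rw [indicator_of_mem, hF1 x h ⟨hx, hh⟩]
          refine ⟨?_, hh.2⟩
          simpa [B] using hh.1
        · rw [indicator_of_notMem, hF0 x h fun H => hh H.2]
          refine fun H => hh ⟨?_, H.2⟩
          simpa [B] using H.1
    _ ≤ (volume B)⁻¹ * ∫⁻ x, ∫⁻ h, F (x, h) := by
        rw [lintegral_const_mul' _ _ hB]
        gcongr
        exact Measure.restrict_le_self
    _ = (volume B)⁻¹ * ∫⁻ h, ∫⁻ x, F (x, h) := by
        rw [lintegral_lintegral_swap (f := fun x h => F (x, h)) hF.aemeasurable]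
    _ = _ := by
        congr 1
        rw [← lintegral_indicator measurableSet_ball]
        congr with h
        by_cases hh : h ∈ B
        · rw [indicator_of_mem hh, ← lintegral_indicator (measurableSet_shiftInter hS h)]
          congr with x
          by_cases hx : x ∈ S ∧ x + h ∈ S
          · rw [hF1 x h ⟨hx.1, hh, hx.2⟩,
              indicator_of_mem (show x ∈ shiftInter S h from hx)]
          · rw [hF0 x h fun H => hx ⟨H.1, H.2.2⟩,
              indicator_of_notMem (show x ∉ shiftInter S h from hx)]
        · rw [indicator_of_notMem hh]
          refine (lintegral_congr fun x => ?_).trans lintegral_zero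
          exact hF0 x h fun H => hh H.2.1

theorem avgModulus_le_omega {n : ℕ} {p : ℝ} (hp : 0 < p) (S : Set (Rn n)) (u : Rn n → EReal)
    (t : ℝ) : avgModulus p S u t ≤ omega p S u t := by
  unfold avgModulus
  rw [one_div, ENNReal.rpow_inv_le_iff hp]
  calc _ ≤ (volume (Metric.ball (0 : Rn n) t))⁻¹ *
        ∫⁻ h in Metric.ball (0 : Rn n) t, omega p S u t ^ p := by
        refine mul_le_mul_right (setLIntegral_mono' measurableSet_ball fun h hh => ?_) _
        rw [← ENNReal.rpow_inv_le_iff hp, ← one_div]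
        exact le_iSup₂ (f := fun (h : Rn n) (_ : ‖h‖ ≤ t) =>
          (∫⁻ x in shiftInter S h, absDiff (u (x + h)) (u x) ^ p) ^ (1 / p)) h
          (mem_ball_zero_iff.1 hh).le
    _ = omega p S u t ^ p * ((volume (Metric.ball (0 : Rn n) t))⁻¹ *
          volume (Metric.ball (0 : Rn n) t)) := by
        rw [setLIntegral_const, mul_left_comm]
    _ ≤ omega p S u t ^ p := mul_le_of_le_one_right' (ENNReal.inv_mul_le_one _)

/-! ### The Hajłasz–Besov norm controls the modulus of smoothness -/

/-- A translation by `h` of dyadic size `2^{-j}` only sees the gradient at level `j`. -/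
theorem exists_lintegral_shiftInter_le {p : ℝ} (hp : 0 < p) :
    ∃ K : ℝ≥0∞, K ≠ ∞ ∧ ∀ {n : ℕ} {s : ℝ} (_ : 0 < s) {S : Set (Rn n)} (_ : MeasurableSet S)
      {v : Rn n → ℝ} {g : ℤ → Rn n → ℝ≥0∞}
      (_ : IsFracGradient s S (fun x => (v x : EReal)) g) {j : ℤ} {h : Rn n}
      (_ : ‖h‖ ∈ dyadicIco j),
      (∫⁻ x in shiftInter S h, ‖v (x + h) - v x‖ₑ ^ p) ^ (1 / p) ≤
        K * (ENNReal.ofReal (((2 : ℝ) ^ (-j)) ^ s) * (∫⁻ x in S, g j x ^ p) ^ (1 / p)) := by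
  refine ⟨((2 : ℝ≥0∞) ^ p * 2) ^ (1 / p), by finiteness, ?_⟩
  intro n s hs S hS v g ⟨hgm, E, hES, hE0, hg⟩ j h hh
  have hSh := measurableSet_shiftInter hS h
  set D := ENNReal.ofReal (((2 : ℝ) ^ (-j)) ^ s)
  set G : Rn n → ℝ≥0∞ := S.indicator (g j)
  have hG : AEMeasurable G := (aemeasurable_indicator_iff hS).2 (hgm j)
  have hGS : ∫⁻ x, G x ^ p = ∫⁻ x in S, g j x ^ p := by
    rw [← lintegral_indicator hS]
    congr with x
    by_cases hx : x ∈ S <;> simp [G, hx, hp]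
  have hE1 : ∀ᵐ x : Rn n, x ∉ E := measure_eq_zero_iff_ae_notMem.1 hE0
  have hE2 : ∀ᵐ x : Rn n, x + h ∉ E :=
    (quasiMeasurePreserving_add_right volume h).ae hE1
  have key : ∫⁻ x in shiftInter S h, ‖v (x + h) - v x‖ₑ ^ p ≤
      (2 ^ p * 2) * (D ^ p * ∫⁻ x in S, g j x ^ p) := by
    calc _ ≤ ∫⁻ x in shiftInter S h, D ^ p * (2 ^ p * (G (x + h) ^ p + G x ^ p)) := by
          refine lintegral_mono_ae ((ae_restrict_iff' hSh).2 ?_)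
          filter_upwards [hE1, hE2] with x hx1 hx2 hx
          have hd : dist (x + h) x = ‖h‖ := by simp [dist_eq_norm]
          have := hg j (x + h) ⟨hx.2, hx2⟩ x ⟨hx.1, hx1⟩ (by rw [hd]; exact hh.1)
            (by rw [hd]; exact hh.2)
          rw [absDiff_coe, hd] at this
          calc ‖v (x + h) - v x‖ₑ ^ p ≤ (D * (G (x + h) + G x)) ^ p := by
                refine ENNReal.rpow_le_rpow (this.trans ?_) hp.le
                simp only [G, indicator_of_mem hx.1, indicator_of_mem hx.2]
                gcongr
                exact ENNReal.ofReal_le_ofReal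
                  (Real.rpow_le_rpow (norm_nonneg _) hh.2.le hs.le)
            _ ≤ _ := by
                rw [ENNReal.mul_rpow_of_nonneg _ _ hp.le]
                gcongr
                exact add_rpow_le hp.le _ _
      _ ≤ ∫⁻ x, D ^ p * (2 ^ p * (G (x + h) ^ p + G x ^ p)) := setLIntegral_le_lintegral _ _
      _ = _ := by
          rw [lintegral_const_mul' _ _ (by finiteness), lintegral_const_mul' _ _ (by finiteness),
            lintegral_add_right' _ (hG.pow_const p),
            lintegral_add_right_eq_self (fun x => G x ^ p) h, hGS]
          ring
  calc _ ≤ ((2 ^ p * 2) * (D ^ p * ∫⁻ x in S, g j x ^ p)) ^ (1 / p) :=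
        ENNReal.rpow_le_rpow key (by positivity)
    _ = _ := by
      rw [ENNReal.mul_rpow_of_nonneg _ _ (by positivity),
        ENNReal.mul_rpow_of_nonneg (D ^ p) _ (by positivity), rpow_rpow_inv' hp]

/-- At scale `t ≥ 2^{-k-1}` the translations of size `2^{-k-i}` carry the decay `2^{-is}`. -/
theorem exists_scaleNorm_omega_le_gradNorm {s p : ℝ} {q : ℝ≥0∞} (hs : 0 < s) (hp : 0 < p)
    (hq : 0 < q) :
    ∃ K : ℝ≥0∞, K ≠ ∞ ∧ ∀ {n : ℕ} {S : Set (Rn n)} (_ : MeasurableSet S)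
      {v : Rn n → ℝ} {g : ℤ → Rn n → ℝ≥0∞}
      (_ : IsFracGradient s S (fun x => (v x : EReal)) g),
      scaleNorm s q (omega p S fun x => (v x : EReal)) ≤ K * gradNorm p q S g := by
  obtain ⟨K₁, hK₁, h₁⟩ := exists_lintegral_shiftInter_le hp
  set ρ : ℝ≥0∞ := ENNReal.ofReal ((2 : ℝ) ^ (-s))
  have hρ : ρ < 1 :=
    ENNReal.ofReal_lt_one.2 (Real.rpow_lt_one_of_one_lt_of_neg one_lt_two (neg_lt_zero.2 hs))
  obtain ⟨K₂, hK₂, h₂⟩ := exists_seqNorm_iSup_le hρ hq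
  refine ⟨ENNReal.ofReal (2 ^ s) * K₁ * K₂, by finiteness, ?_⟩
  intro n S hS v g hg
  set a : ℤ → ℝ≥0∞ := fun k => (∫⁻ x in S, g k x ^ p) ^ (1 / p)
  calc _ ≤ seqNorm q (fun k => ENNReal.ofReal (2 ^ s) * K₁ * ⨆ i : ℕ, ρ ^ i * a (k + i)) := by
        refine scaleNorm_le_seqNorm fun k t ht => ?_
        have ht0 := pos_of_mem_dyadicIco ht
        rw [omega]
        simp_rw [ENNReal.mul_iSup]
        refine iSup₂_le fun h hh => ?_
        rcases eq_or_ne h 0 with rfl | h0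
        · simp [absDiff_coe, hp]
        obtain ⟨j, hj⟩ := exists_mem_dyadicIco (norm_pos_iff.2 h0)
        obtain ⟨i, rfl⟩ := Int.le.dest (le_of_mem_dyadicIco_of_le ht hj hh)
        refine le_iSup_of_le i ?_
        simp only [absDiff_coe]
        refine (mul_le_mul_right (h₁ hs hS hg hj) _).trans ?_
        have hr : t ^ (-s) * ((2 : ℝ) ^ (-(k + i : ℤ))) ^ s ≤ 2 ^ s * ((2 : ℝ) ^ (-s)) ^ i := by
          have h2 : t ^ (-s) ≤ ((2 : ℝ) ^ (-k - 1)) ^ (-s) :=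
            Real.rpow_le_rpow_of_nonpos (by positivity) ht.1 (by linarith)
          refine (mul_le_mul_of_nonneg_right h2 (by positivity)).trans_eq ?_
          rw [← Real.rpow_intCast, ← Real.rpow_mul two_pos.le, ← Real.rpow_intCast,
            ← Real.rpow_mul two_pos.le, ← Real.rpow_add two_pos, ← Real.rpow_natCast,
            ← Real.rpow_mul two_pos.le, ← Real.rpow_add two_pos]
          congr 1
          push_cast
          ring
        have hr' := ENNReal.ofReal_le_ofReal hr
        rw [ENNReal.ofReal_mul (by positivity), ENNReal.ofReal_mul (by positivity),
          ENNReal.ofReal_pow (by positivity)] at hr'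
        calc _ = K₁ * ((ENNReal.ofReal (t ^ (-s)) *
              ENNReal.ofReal (((2 : ℝ) ^ (-(k + i : ℤ))) ^ s)) * a (k + i)) := by
              simp only [a]; ring
          _ ≤ K₁ * ((ENNReal.ofReal (2 ^ s) * ρ ^ i) * a (k + i)) := by gcongr
          _ = _ := by ring
    _ ≤ _ := by
        rw [seqNorm_const_mul q hq, mul_assoc _ K₂]
        gcongr
        exact h₂ a

/-! ### Approximate continuity and chains of approximating constants -/

/-- `v` is approximately continuous at `x` relative to `S`, in the weak sense that every
neighbourhood of `v x` is taken on more than half of each small ball. -/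
def ApproxContinuousAt {n : ℕ} (S : Set (Rn n)) (v : Rn n → ℝ) (x : Rn n) : Prop :=
  ∀ η : ℝ, 0 < η → ∀ᶠ r in nhdsWithin (0 : ℝ) (Ioi 0),
    volume (Metric.closedBall x r) < 2 * volume ((S ∩ {y | |v y - v x| < η}) ∩ Metric.closedBall x r)

/-- Lebesgue's density theorem, applied to the preimages of rational intervals. Unlike the
differentiation theorem it requires no integrability of `v`. -/
theorem ae_approxContinuousAt {n : ℕ} {S : Set (Rn n)} (hS : MeasurableSet S) {v : Rn n → ℝ}
    (hv : Measurable v) : ∀ᵐ x : Rn n, x ∈ S → ApproxContinuousAt S v x := by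
  have h (a b : ℚ) := Besicovitch.ae_tendsto_measure_inter_div_of_measurableSet
    (volume : Measure (Rn n)) (hS.inter (hv (measurableSet_Ioo (a := (a : ℝ)) (b := (b : ℝ)))))
  simp_rw [← ae_all_iff] at h
  filter_upwards [h] with x hx hxS η hη
  obtain ⟨a, ha1, ha2⟩ := exists_rat_btwn (sub_lt_self (v x) hη)
  obtain ⟨b, hb1, hb2⟩ := exists_rat_btwn (lt_add_of_pos_right (v x) hη)
  have hmem : x ∈ S ∩ v ⁻¹' Ioo (a : ℝ) b := ⟨hxS, ha2, hb1⟩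
  have hlim := hx a b
  rw [indicator_of_mem hmem, Pi.one_apply] at hlim
  have hhalf : (2 : ℝ≥0∞)⁻¹ < 1 := ENNReal.inv_lt_one.2 ENNReal.one_lt_two
  filter_upwards [hlim.eventually (lt_mem_nhds hhalf), self_mem_nhdsWithin] with r hr hr0
  have hpos : volume (Metric.closedBall x r) ≠ 0 :=
    (Metric.measure_closedBall_pos volume x hr0).ne'
  rw [ENNReal.lt_div_iff_mul_lt (Or.inl hpos) (Or.inl measure_closedBall_lt_top.ne)] at hr
  have hr2 := (ENNReal.mul_lt_mul_iff_right two_ne_zero ENNReal.ofNat_ne_top).2 hr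
  rw [← mul_assoc, ENNReal.mul_inv_cancel two_ne_zero ENNReal.ofNat_ne_top, one_mul] at hr2
  refine hr2.trans_le ?_
  gcongr 2 * volume (S ∩ ?_ ∩ _)
  intro y hy
  simp only [mem_preimage, mem_Ioo, mem_ofPred_eq, abs_lt] at hy ⊢
  constructor <;> linarith [hy.1, hy.2]

/-- Chebyshev's inequality for two functions at once. -/
theorem exists_mem_abs_sub_le {n : ℕ} {p : ℝ} (hp : 0 < p) {D : Set (Rn n)}
    {v : Rn n → ℝ} (hv : Measurable v) {l a a' c c' : ℝ} (hl : 0 < l) (ha : 0 < a) (ha' : 0 < a')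
    {V : ℝ≥0∞} (h : ∫⁻ y in D, ‖v y - c‖ₑ ^ p ≤ ENNReal.ofReal a ^ p * V)
    (h' : ∫⁻ y in D, ‖v y - c'‖ₑ ^ p ≤ ENNReal.ofReal a' ^ p * V)
    (hV : 2 * V < ENNReal.ofReal l ^ p * volume D) :
    ∃ z ∈ D, |v z - c| ≤ l * a ∧ |v z - c'| ≤ l * a' := by
  by_contra! H
  refine hV.not_ge ?_
  have aux {a c : ℝ} (ha : 0 < a) {z : Rn n} (hz : l * a < |v z - c|) :
      ENNReal.ofReal l ^ p ≤ ‖v z - c‖ₑ ^ p / ENNReal.ofReal a ^ p := by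
    have ha0 : ENNReal.ofReal a ≠ 0 := (ENNReal.ofReal_pos.2 ha).ne'
    rw [ENNReal.le_div_iff_mul_le (Or.inl (by simp [ha0]))
      (Or.inl (by finiteness)), ← ENNReal.mul_rpow_of_nonneg _ _ hp.le,
      ← ENNReal.ofReal_mul hl.le, Real.enorm_eq_ofReal_abs]
    exact ENNReal.rpow_le_rpow (ENNReal.ofReal_le_ofReal hz.le) hp.le
  have aux2 {a c : ℝ} (ha : 0 < a)
      (h : ∫⁻ y in D, ‖v y - c‖ₑ ^ p ≤ ENNReal.ofReal a ^ p * V) :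
      ∫⁻ y in D, ‖v y - c‖ₑ ^ p / ENNReal.ofReal a ^ p ≤ V := by
    have ha0 : ENNReal.ofReal a ^ p ≠ 0 :=
      (ENNReal.rpow_pos (ENNReal.ofReal_pos.2 ha) ENNReal.ofReal_ne_top).ne'
    simp_rw [div_eq_mul_inv]
    rw [lintegral_mul_const' _ _ (ENNReal.inv_ne_top.2 ha0), ← div_eq_mul_inv]
    exact ENNReal.div_le_of_le_mul' h
  calc ENNReal.ofReal l ^ p * volume D = ∫⁻ _ in D, ENNReal.ofReal l ^ p :=
        (setLIntegral_const _ _).symm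
    _ ≤ ∫⁻ y in D, (‖v y - c‖ₑ ^ p / ENNReal.ofReal a ^ p +
          ‖v y - c'‖ₑ ^ p / ENNReal.ofReal a' ^ p) := by
        refine setLIntegral_mono (by fun_prop) fun y hy => ?_
        rcases le_or_gt (|v y - c|) (l * a) with h1 | h1
        · exact (aux ha' (H y hy h1)).trans le_add_self
        · exact (aux ha h1).trans le_self_add
    _ ≤ V + V := by
        rw [lintegral_add_left (by fun_prop)]
        exact add_le_add (aux2 ha h) (aux2 ha' h')
    _ = 2 * V := (two_mul V).symm

theorem volume_ball_eq_two_pow_mul {n : ℕ} (x : Rn n) {r : ℝ} :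
    volume (Metric.ball x r) = 2 ^ n * volume (Metric.ball x (r / 2)) := by
  have h := Measure.addHaar_ball_mul_of_pos (volume : Measure (Rn n)) x two_pos (r / 2)
  rw [mul_div_cancel₀ r two_ne_zero, finrank_euclideanSpace_fin, ENNReal.ofReal_pow two_pos.le,
    ENNReal.ofReal_ofNat] at h
  rw [h, Measure.addHaar_ball_center volume x]

/-- The level at which Chebyshev's inequality yields a common good point on a portion of relative
measure `cm` of a half-sized ball. -/
theorem exists_chebyshev_level (n : ℕ) {p cm : ℝ} (hp : 0 < p) (hcm : 0 < cm) :
    ∃ l : ℝ, 0 < l ∧ 2 * 2 ^ n < ENNReal.ofReal l ^ p * ENNReal.ofReal cm ∧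
      2 * 2 ^ n * 2 ≤ ENNReal.ofReal l ^ p := by
  set L : ℝ := 2 * 2 ^ n * 2 * (1 + 1 / cm)
  have hL : 0 < L := by positivity
  refine ⟨L ^ (1 / p), by positivity, ?_⟩
  rw [ENNReal.ofReal_rpow_of_pos (by positivity), ← Real.rpow_mul hL.le,
    one_div_mul_cancel hp.ne', Real.rpow_one, ← ENNReal.ofReal_mul hL.le]
  have h2 : (2 : ℝ≥0∞) * 2 ^ n = ENNReal.ofReal (2 * 2 ^ n) := by
    rw [ENNReal.ofReal_mul two_pos.le, ENNReal.ofReal_pow two_pos.le, ENNReal.ofReal_ofNat]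
  have h3 : (2 : ℝ≥0∞) * 2 ^ n * 2 = ENNReal.ofReal (2 * 2 ^ n * 2) := by
    rw [h2, ENNReal.ofReal_mul (by positivity : (0 : ℝ) ≤ 2 * 2 ^ n), ENNReal.ofReal_ofNat]
  have hpos : (0 : ℝ) < 2 * 2 ^ n := by positivity
  rw [h3, h2]
  constructor
  · rw [ENNReal.ofReal_lt_ofReal_iff (by positivity)]
    have : L * cm = 2 * 2 ^ n * 2 * (cm + 1) := by simp only [L]; field_simp
    rw [this]
    nlinarith
  · refine ENNReal.ofReal_le_ofReal (le_mul_of_one_le_right (by positivity) ?_)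
    linarith [one_div_pos.2 hcm]

section Chain

variable {n : ℕ} {p cm l ρ M : ℝ} {S : Set (Rn n)} {v : Rn n → ℝ}

theorem two_mul_volume_ball_lt (hd : MeasureDensity cm S)
    (hl : 2 * 2 ^ n < ENNReal.ofReal l ^ p * ENNReal.ofReal cm) {x : Rn n} (hx : x ∈ S) {r : ℝ}
    (hr : 0 < r) (hr1 : r ≤ 1) :
    2 * volume (Metric.ball x r) <
      ENNReal.ofReal l ^ p * volume (Metric.ball x (r / 2) ∩ S) := by
  have hpos : volume (Metric.ball x (r / 2)) ≠ 0 :=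
    (Metric.measure_ball_pos _ _ (half_pos hr)).ne'
  calc 2 * volume (Metric.ball x r) = 2 * 2 ^ n * volume (Metric.ball x (r / 2)) := by
        rw [volume_ball_eq_two_pow_mul, mul_assoc]
    _ < ENNReal.ofReal l ^ p * ENNReal.ofReal cm * volume (Metric.ball x (r / 2)) :=
        (ENNReal.mul_lt_mul_iff_left hpos measure_ball_lt_top.ne).2 hl
    _ ≤ _ := by
        rw [mul_assoc, inter_comm]
        gcongr
        exact hd x hx _ (half_pos hr) (by linarith)

/-- If the constants `c i` approximate `v` on the balls `B(x, r / 2 ^ i)` with geometrically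
decaying errors, then consecutive constants are close and `c i` tends to `v x`. -/
theorem abs_sub_le_of_geometric_approx (hp : 0 < p) (hv : Measurable v)
    (hd : MeasureDensity cm S) (hl0 : 0 < l)
    (hl : 2 * 2 ^ n < ENNReal.ofReal l ^ p * ENNReal.ofReal cm)
    (hl' : 2 * 2 ^ n * 2 ≤ ENNReal.ofReal l ^ p) (hρ0 : 0 < ρ) (hρ1 : ρ < 1) (hM : 0 < M)
    {x : Rn n} (hx : x ∈ S) (hxv : ApproxContinuousAt S v x) {r : ℝ} (hr : 0 < r) (hr1 : r ≤ 1)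
    {c : ℕ → ℝ}
    (h : ∀ i : ℕ, ∫⁻ y in Metric.ball x (r / 2 ^ i) ∩ S, ‖v y - c i‖ₑ ^ p ≤
      ENNReal.ofReal (M * ρ ^ i) ^ p * volume (Metric.ball x (r / 2 ^ i))) :
    |v x - c 0| ≤ l * (1 + 2 / (1 - ρ)) * M := by
  have hri (i : ℕ) : 0 < r / 2 ^ i := by positivity
  have hri1 (i : ℕ) : r / 2 ^ i ≤ 1 :=
    (div_le_self hr.le (one_le_pow₀ one_le_two)).trans hr1
  have hsucc (i : ℕ) : r / 2 ^ (i + 1) = r / 2 ^ i / 2 := by rw [pow_succ, div_div]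
  have hstep (i : ℕ) : |c i - c (i + 1)| ≤ 2 * l * M * ρ ^ i := by
    have hsub : Metric.ball x (r / 2 ^ (i + 1)) ⊆ Metric.ball x (r / 2 ^ i) := by
      refine Metric.ball_subset_ball ?_
      rw [hsucc]
      linarith [hri i]
    obtain ⟨z, -, hz, hz'⟩ := exists_mem_abs_sub_le hp hv hl0
      (by positivity : 0 < M * ρ ^ i) (by positivity : 0 < M * ρ ^ (i + 1))
      (V := volume (Metric.ball x (r / 2 ^ i)))
      ((lintegral_mono_set (inter_subset_inter_left _ hsub)).trans (h i))
      ((h (i + 1)).trans (by gcongr))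
      (by rw [hsucc]; exact two_mul_volume_ball_lt hd hl hx (hri i) (hri1 i))
    have h1 : l * (M * ρ ^ (i + 1)) ≤ l * (M * ρ ^ i) := by
      gcongr ?_ * (?_ * ?_)
      exact pow_le_pow_of_le_one hρ0.le hρ1.le (Nat.le_succ i)
    rw [abs_le] at hz hz' ⊢
    constructor <;> linarith [hz.1, hz.2, hz'.1, hz'.2]
  have hchain (i : ℕ) : |c 0 - c i| ≤ 2 * l * M / (1 - ρ) * (1 - ρ ^ i) := by
    induction i with
    | zero => simp
    | succ i ih =>
      have h1 : 2 * l * M / (1 - ρ) * (1 - ρ) = 2 * l * M :=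
        div_mul_cancel₀ _ (by linarith)
      calc |c 0 - c (i + 1)| ≤ |c 0 - c i| + |c i - c (i + 1)| := abs_sub_le _ _ _
        _ ≤ 2 * l * M / (1 - ρ) * (1 - ρ ^ i) + 2 * l * M / (1 - ρ) * (1 - ρ) * ρ ^ i := by
            rw [h1]; exact add_le_add ih (hstep i)
        _ = _ := by ring
  have hK : 0 ≤ 2 * l * M / (1 - ρ) := by
    have : 0 < 1 - ρ := by linarith
    positivity
  refine le_of_forall_pos_le_add fun η hη => ?_
  have hlim : Filter.Tendsto (fun i : ℕ => r / 2 ^ i / 2) Filter.atTop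
      (nhdsWithin 0 (Ioi 0)) := by
    refine tendsto_nhdsWithin_iff.2 ⟨?_, Filter.Eventually.of_forall fun i => ?_⟩
    · have := (tendsto_pow_atTop_nhds_zero_of_lt_one (by norm_num : (0 : ℝ) ≤ 1 / 2)
        (by norm_num)).const_mul (r / 2)
      rw [mul_zero] at this
      refine this.congr fun i => ?_
      rw [one_div, inv_pow]
      ring
    · exact half_pos (hri i)
  -- At a sufficiently small radius, a point with value near `v x` is also a Chebyshev point of `c i`.
  obtain ⟨i, hi⟩ := (hlim.eventually (hxv η hη)).exists
  have hsub : (S ∩ {y | |v y - v x| < η}) ∩ Metric.closedBall x (r / 2 ^ i / 2) ⊆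
      Metric.ball x (r / 2 ^ i) ∩ S := fun y hy =>
    ⟨Metric.closedBall_subset_ball (half_lt_self (hri i)) hy.2, hy.1.1⟩
  obtain ⟨z, hzD, hz, -⟩ := exists_mem_abs_sub_le (l := l) (V := volume (Metric.ball x (r / 2 ^ i)))
    (D := (S ∩ {y | |v y - v x| < η}) ∩ Metric.closedBall x (r / 2 ^ i / 2)) hp hv hl0
    (by positivity : 0 < M * ρ ^ i) (by positivity : 0 < M * ρ ^ i) (c := c i) (c' := c i)
    ((lintegral_mono_set hsub).trans (h i))
    ((lintegral_mono_set hsub).trans (h i)) (by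
      calc 2 * volume (Metric.ball x (r / 2 ^ i))
          = 2 * 2 ^ n * volume (Metric.ball x (r / 2 ^ i / 2)) := by
            rw [volume_ball_eq_two_pow_mul, mul_assoc]
        _ ≤ 2 * 2 ^ n * volume (Metric.closedBall x (r / 2 ^ i / 2)) := by
            gcongr; exact Metric.ball_subset_closedBall
        _ < 2 * 2 ^ n * (2 * volume ((S ∩ {y | |v y - v x| < η}) ∩
              Metric.closedBall x (r / 2 ^ i / 2))) :=
            (ENNReal.mul_lt_mul_iff_right (by positivity) (by finiteness)).2 hi
        _ ≤ _ := by
            rw [← mul_assoc]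
            gcongr)
  have hzη : |v z - v x| < η := hzD.1.2
  have hρi : ρ ^ i ≤ 1 := pow_le_one₀ hρ0.le hρ1.le
  have h1 : l * (M * ρ ^ i) ≤ l * M := by
    rw [← mul_assoc]; exact mul_le_of_le_one_right (by positivity) hρi
  have h2 : 2 * l * M / (1 - ρ) * (1 - ρ ^ i) ≤ 2 * l * M / (1 - ρ) :=
    mul_le_of_le_one_right hK (by linarith [pow_pos hρ0 i])
  have h3 : l * (1 + 2 / (1 - ρ)) * M = l * M + 2 * l * M / (1 - ρ) := by ring
  have h4 := hchain i
  rw [h3]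
  rw [abs_le] at hz h4 ⊢
  rw [abs_lt] at hzη
  constructor <;> linarith [hz.1, hz.2, h4.1, h4.2, hzη.1, hzη.2]

/-- For nearby points the first constants are compared on `B(x, r / 2) ∩ S`, which lies in both of
the balls of radius `r`. -/
theorem abs_sub_le_of_geometric_approx₂ (hp : 0 < p) (hv : Measurable v)
    (hd : MeasureDensity cm S) (hl0 : 0 < l)
    (hl : 2 * 2 ^ n < ENNReal.ofReal l ^ p * ENNReal.ofReal cm)
    (hl' : 2 * 2 ^ n * 2 ≤ ENNReal.ofReal l ^ p) (hρ0 : 0 < ρ) (hρ1 : ρ < 1) (hM : 0 < M)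
    {x y : Rn n} (hx : x ∈ S) (hxv : ApproxContinuousAt S v x) (hy : y ∈ S)
    (hyv : ApproxContinuousAt S v y) {r : ℝ} (hr : 0 < r) (hr1 : r ≤ 1)
    (hxy : dist x y ≤ r / 2) {c c' : ℕ → ℝ}
    (h : ∀ i : ℕ, ∫⁻ z in Metric.ball x (r / 2 ^ i) ∩ S, ‖v z - c i‖ₑ ^ p ≤
      ENNReal.ofReal (M * ρ ^ i) ^ p * volume (Metric.ball x (r / 2 ^ i)))
    (h' : ∀ i : ℕ, ∫⁻ z in Metric.ball y (r / 2 ^ i) ∩ S, ‖v z - c' i‖ₑ ^ p ≤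
      ENNReal.ofReal (M * ρ ^ i) ^ p * volume (Metric.ball y (r / 2 ^ i))) :
    |v x - v y| ≤ l * (4 + 4 / (1 - ρ)) * M := by
  have h1 := abs_sub_le_of_geometric_approx hp hv hd hl0 hl hl' hρ0 hρ1 hM hx hxv hr hr1 h
  have h2 := abs_sub_le_of_geometric_approx hp hv hd hl0 hl hl' hρ0 hρ1 hM hy hyv hr hr1 h'
  have h0 := h 0
  have h0' := h' 0
  rw [pow_zero, pow_zero, div_one, mul_one] at h0 h0'
  rw [Measure.addHaar_ball_center, ← Measure.addHaar_ball_center volume x] at h0'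
  obtain ⟨z, -, hz, hz'⟩ := exists_mem_abs_sub_le hp hv hl0 hM hM
    ((lintegral_mono_set (inter_subset_inter_left _
      (Metric.ball_subset_ball (half_le_self hr.le)))).trans h0)
    ((lintegral_mono_set (inter_subset_inter_left _
      (Metric.ball_subset_ball' (by linarith)))).trans h0')
    (two_mul_volume_ball_lt hd hl hx hr hr1)
  have h3 : l * (4 + 4 / (1 - ρ)) * M = 2 * (l * (1 + 2 / (1 - ρ)) * M) + 2 * (l * M) := by ring
  rw [h3]
  rw [abs_le] at *
  constructor <;> linarith [hz.1, hz.2, hz'.1, hz'.2, h1.1, h1.2, h2.1, h2.2]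

end Chain

/-! ### Local oscillation -/

/-- The local oscillation of `v` on `B(x, r) ∩ S`. The approximating constants are rational, which
makes it measurable in `x`; up to a factor this is no restriction. -/
def localOsc {n : ℕ} (p : ℝ) (S : Set (Rn n)) (v : Rn n → ℝ) (r : ℝ) (x : Rn n) : ℝ≥0∞ :=
  (volume (Metric.ball x r))⁻¹ * ⨅ c : ℚ, ∫⁻ y in Metric.ball x r ∩ S, ‖v y - c‖ₑ ^ p

theorem measurable_localOsc {n : ℕ} (p : ℝ) {S : Set (Rn n)} (hS : MeasurableSet S)
    {v : Rn n → ℝ} (hv : Measurable v) (r : ℝ) : Measurable (localOsc p S v r) := by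
  unfold localOsc
  simp_rw [Measure.addHaar_ball_center]
  refine Measurable.const_mul (Measurable.iInf fun c => ?_) _
  set A : Set (Rn n × Rn n) := {z | dist z.2 z.1 < r ∧ z.2 ∈ S}
  have hA : MeasurableSet A :=
    (measurableSet_lt (measurable_snd.dist measurable_fst) measurable_const).inter
      (measurable_snd hS)
  have hF : Measurable (A.indicator fun z => ‖v z.2 - c‖ₑ ^ p) := by
    refine Measurable.indicator ?_ hA
    fun_prop
  convert hF.lintegral_prod_right' (ν := volume) using 2 with x
  rw [← lintegral_indicator (measurableSet_ball.inter hS)]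
  rfl

theorem iInf_rat_lintegral_le {n : ℕ} {p : ℝ} (hp : 0 < p) {D : Set (Rn n)} (hD : volume D ≠ ∞)
    {v : Rn n → ℝ} (hv : Measurable v) :
    ⨅ c : ℚ, ∫⁻ y in D, ‖v y - c‖ₑ ^ p ≤ 2 ^ p * ⨅ c : ℝ, ∫⁻ y in D, ‖v y - c‖ₑ ^ p := by
  rw [ENNReal.mul_iInf_of_ne (by positivity) (by finiteness)]
  refine le_iInf fun c => ?_
  set A := ∫⁻ y in D, ‖v y - c‖ₑ ^ p
  have hlim : Filter.Tendsto (fun δ : ℝ => 2 ^ p * (A + ENNReal.ofReal δ ^ p * volume D))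
      (nhdsWithin 0 (Ioi 0)) (nhds (2 ^ p * A)) := by
    have h1 : Filter.Tendsto (fun δ : ℝ => ENNReal.ofReal δ ^ p * volume D)
        (nhdsWithin 0 (Ioi 0)) (nhds 0) := by
      have h2 : Continuous fun δ : ℝ => ENNReal.ofReal δ ^ p :=
        ENNReal.continuous_rpow_const.comp ENNReal.continuous_ofReal
      have h3 := ENNReal.Tendsto.mul_const (h2.tendsto 0) (b := volume D) (Or.inr hD)
      simp only [ENNReal.ofReal_zero, ENNReal.zero_rpow_of_pos hp, zero_mul] at h3
      exact h3.mono_left nhdsWithin_le_nhds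
    have h4 := ENNReal.Tendsto.const_mul (a := 2 ^ p) (h1.const_add A) (Or.inr (by finiteness))
    rwa [add_zero] at h4
  refine ge_of_tendsto hlim ?_
  filter_upwards [self_mem_nhdsWithin] with δ hδ
  obtain ⟨b, hb1, hb2⟩ := exists_rat_btwn (lt_add_of_pos_right c hδ)
  refine (iInf_le _ b).trans ?_
  calc ∫⁻ y in D, ‖v y - b‖ₑ ^ p
      ≤ ∫⁻ y in D, 2 ^ p * (‖v y - c‖ₑ ^ p + ENNReal.ofReal δ ^ p) := by
        refine lintegral_mono fun y => ?_
        refine le_trans ?_ (add_rpow_le hp.le _ _)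
        refine ENNReal.rpow_le_rpow ?_ hp.le
        have h1 : v y - b = (v y - c) + (c - b) := by ring
        rw [h1]
        refine (enorm_add_le _ _).trans (add_le_add le_rfl ?_)
        rw [Real.enorm_eq_ofReal_abs]
        refine ENNReal.ofReal_le_ofReal (abs_le.2 ⟨?_, ?_⟩) <;> linarith [mem_Ioi.1 hδ]
    _ = _ := by
        rw [lintegral_const_mul' _ _ (by finiteness), lintegral_add_left (by fun_prop),
          setLIntegral_const]

theorem lintegral_localOsc_le {n : ℕ} {p : ℝ} (hp : 0 < p) {S : Set (Rn n)}
    (hS : MeasurableSet S) {v : Rn n → ℝ} (hv : Measurable v) (r : ℝ) :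
    ∫⁻ x in S, localOsc p S v r x ≤ (2 * hatModulus p S (fun x => (v x : EReal)) r) ^ p := by
  rw [ENNReal.mul_rpow_of_nonneg _ _ hp.le, hatModulus, rpow_inv_rpow hp,
    ← lintegral_const_mul' _ _ (by finiteness)]
  simp only [absDiff_coe]
  refine setLIntegral_mono' hS fun x hx => ?_
  rw [localOsc, mul_left_comm]
  gcongr
  exact iInf_rat_lintegral_le hp
    ((measure_mono inter_subset_left).trans_lt measure_ball_lt_top).ne hv

/-- At the smaller radius the ball has comparable volume and the infimum is smaller. -/
theorem hatModulus_le_of_le {n : ℕ} {p : ℝ} (hp : 0 < p) (S : Set (Rn n)) (u : Rn n → EReal)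
    {r t : ℝ} (hrt : r ≤ t) (htr : t ≤ 2 * r) :
    hatModulus p S u r ≤ (2 ^ n) ^ (1 / p) * hatModulus p S u t := by
  unfold hatModulus
  rw [← ENNReal.mul_rpow_of_nonneg _ _ (by positivity), ← lintegral_const_mul' _ _ (by finiteness)]
  refine ENNReal.rpow_le_rpow (lintegral_mono fun x => ?_) (by positivity)
  rw [← mul_assoc]
  refine mul_le_mul' ?_ (iInf_mono fun c => lintegral_mono_set
    (inter_subset_inter_left _ (Metric.ball_subset_ball hrt)))
  rw [← ENNReal.inv_le_inv, inv_inv, ENNReal.mul_inv (Or.inl (by positivity))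
    (Or.inl (by finiteness)), inv_inv, mul_comm, ← div_eq_mul_inv]
  refine ENNReal.div_le_of_le_mul' ?_
  have := volume_ball_eq_two_pow_mul x (r := 2 * r)
  rw [mul_div_cancel_left₀ r two_ne_zero] at this
  rw [← this]
  exact measure_mono (Metric.ball_subset_ball htr)

/-- The maximal oscillation over the radii `r / 2 ^ i`, weighted by `ρ⁻¹ ^ i`: it is at most `M` if
the oscillation on `B(x, r / 2 ^ i)` is at most `M * ρ ^ i` for every `i`. -/
def maxOsc {n : ℕ} (p ρ : ℝ) (S : Set (Rn n)) (v : Rn n → ℝ) (r : ℝ) (x : Rn n) : ℝ≥0∞ :=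
  ⨆ i : ℕ, ENNReal.ofReal ρ⁻¹ ^ i * localOsc p S v (r / 2 ^ i) x ^ (1 / p)

theorem measurable_maxOsc {n : ℕ} (p ρ : ℝ) {S : Set (Rn n)} (hS : MeasurableSet S)
    {v : Rn n → ℝ} (hv : Measurable v) (r : ℝ) : Measurable (maxOsc p ρ S v r) :=
  Measurable.iSup fun _ => ((measurable_localOsc p hS hv _).pow_const _).const_mul _

/-- The strict inequality makes near-minimizing constants available without showing that the infimum
is attained. -/
theorem exists_const_of_maxOsc_lt {n : ℕ} {p ρ M r : ℝ} (hp : 0 < p) (hρ : 0 < ρ)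
    {S : Set (Rn n)} {v : Rn n → ℝ} {x : Rn n} (hr : 0 < r)
    (h : maxOsc p ρ S v r x < ENNReal.ofReal M) :
    ∃ c : ℕ → ℝ, ∀ i : ℕ, ∫⁻ y in Metric.ball x (r / 2 ^ i) ∩ S, ‖v y - c i‖ₑ ^ p ≤
      ENNReal.ofReal (M * ρ ^ i) ^ p * volume (Metric.ball x (r / 2 ^ i)) := by
  suffices H : ∀ i : ℕ, ∃ c : ℝ, ∫⁻ y in Metric.ball x (r / 2 ^ i) ∩ S, ‖v y - c‖ₑ ^ p ≤
      ENNReal.ofReal (M * ρ ^ i) ^ p * volume (Metric.ball x (r / 2 ^ i)) by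
    choose c hc using H
    exact ⟨c, hc⟩
  intro i
  have hV : volume (Metric.ball x (r / 2 ^ i)) ≠ 0 :=
    (Metric.measure_ball_pos _ _ (by positivity)).ne'
  have hi : ENNReal.ofReal ρ⁻¹ ^ i * localOsc p S v (r / 2 ^ i) x ^ (1 / p) < ENNReal.ofReal M :=
    (le_iSup (fun i : ℕ => ENNReal.ofReal ρ⁻¹ ^ i * localOsc p S v (r / 2 ^ i) x ^ (1 / p))
      i).trans_lt h
  have hρi : ENNReal.ofReal (ρ ^ i) ≠ 0 := (ENNReal.ofReal_pos.2 (by positivity)).ne'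
  have h1 : localOsc p S v (r / 2 ^ i) x ^ (1 / p) < ENNReal.ofReal (M * ρ ^ i) := by
    have h2 := (ENNReal.mul_lt_mul_iff_left hρi ENNReal.ofReal_ne_top).2 hi
    rw [← ENNReal.ofReal_mul' (by positivity), mul_right_comm,
      ← ENNReal.ofReal_pow (by positivity), ← ENNReal.ofReal_mul (by positivity), ← mul_pow,
      inv_mul_cancel₀ hρ.ne', one_pow, ENNReal.ofReal_one, one_mul] at h2
    exact h2
  rw [one_div, ENNReal.rpow_inv_lt_iff hp, localOsc, mul_comm, ← div_eq_mul_inv,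
    ENNReal.div_lt_iff (Or.inl hV) (Or.inl measure_ball_lt_top.ne), iInf_lt_iff] at h1
  obtain ⟨c, hc⟩ := h1
  exact ⟨c, hc.le⟩

theorem enorm_sub_le_maxOsc {n : ℕ} {p cm l ρ : ℝ} {S : Set (Rn n)} {v : Rn n → ℝ} (hp : 0 < p)
    (hv : Measurable v) (hd : MeasureDensity cm S) (hl0 : 0 < l)
    (hl : 2 * 2 ^ n < ENNReal.ofReal l ^ p * ENNReal.ofReal cm)
    (hl' : 2 * 2 ^ n * 2 ≤ ENNReal.ofReal l ^ p) (hρ0 : 0 < ρ) (hρ1 : ρ < 1)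
    {x y : Rn n} (hx : x ∈ S) (hxv : ApproxContinuousAt S v x) (hy : y ∈ S)
    (hyv : ApproxContinuousAt S v y) {r : ℝ} (hr : 0 < r) (hr1 : r ≤ 1)
    (hxy : dist x y ≤ r / 2) :
    ‖v x - v y‖ₑ ≤ ENNReal.ofReal (l * (4 + 4 / (1 - ρ))) *
      (maxOsc p ρ S v r x + maxOsc p ρ S v r y) := by
  set C : ℝ := l * (4 + 4 / (1 - ρ))
  have hC : 0 < C := by
    have : 0 < 1 - ρ := by linarith
    positivity
  have hC0 : ENNReal.ofReal C ≠ 0 := (ENNReal.ofReal_pos.2 hC).ne'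
  rw [mul_comm, ← ENNReal.div_le_iff hC0 ENNReal.ofReal_ne_top]
  refine le_of_forall_gt_imp_ge_of_dense fun M hM => ?_
  rcases eq_or_ne M ∞ with rfl | hMtop
  · exact le_top
  obtain ⟨m, hm0, rfl⟩ : ∃ m : ℝ, 0 < m ∧ ENNReal.ofReal m = M :=
    ⟨M.toReal, ENNReal.toReal_pos (zero_le.trans_lt hM).ne' hMtop, ENNReal.ofReal_toReal hMtop⟩
  obtain ⟨c, hc⟩ := exists_const_of_maxOsc_lt hp hρ0 hr (le_self_add.trans_lt hM)
  obtain ⟨c', hc'⟩ := exists_const_of_maxOsc_lt hp hρ0 hr (le_add_self.trans_lt hM)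
  have := abs_sub_le_of_geometric_approx₂ hp hv hd hl0 hl hl' hρ0 hρ1 hm0 hx hxv hy hyv hr hr1
    hxy hc hc'
  rw [ENNReal.div_le_iff hC0 ENNReal.ofReal_ne_top, ← ENNReal.ofReal_mul hm0.le, mul_comm m,
    Real.enorm_eq_ofReal_abs]
  exact ENNReal.ofReal_le_ofReal this

/-- The supremum over radii is bounded by the sum, which commutes with the integral. -/
theorem lintegral_maxOsc_rpow_le {n : ℕ} {p ρ : ℝ} (hp : 0 < p) {S : Set (Rn n)}
    (hS : MeasurableSet S) {v : Rn n → ℝ} (hv : Measurable v) (r : ℝ) :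
    ∫⁻ x in S, maxOsc p ρ S v r x ^ p ≤
      ∑' i : ℕ, (ENNReal.ofReal ρ⁻¹ ^ i *
        (2 * hatModulus p S (fun x => (v x : EReal)) (r / 2 ^ i))) ^ p := by
  calc _ ≤ ∫⁻ x in S, ∑' i : ℕ, (ENNReal.ofReal ρ⁻¹ ^ i) ^ p * localOsc p S v (r / 2 ^ i) x := by
        refine lintegral_mono fun x => ?_
        rw [maxOsc, iSup_rpow hp]
        refine (iSup_le_tsum _).trans_eq (tsum_congr fun i => ?_)
        rw [ENNReal.mul_rpow_of_nonneg _ _ hp.le, rpow_inv_rpow hp]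
    _ = ∑' i : ℕ, (ENNReal.ofReal ρ⁻¹ ^ i) ^ p * ∫⁻ x in S, localOsc p S v (r / 2 ^ i) x := by
        rw [lintegral_tsum fun i =>
          ((measurable_localOsc p hS hv _).const_mul _).aemeasurable]
        exact tsum_congr fun i => lintegral_const_mul' _ _ (by finiteness)
    _ ≤ _ := by
        refine ENNReal.tsum_le_tsum fun i => ?_
        rw [ENNReal.mul_rpow_of_nonneg _ (2 * _) hp.le]
        gcongr
        exact lintegral_localOsc_le hp hS hv _

/-! ### The fractional gradient -/

/-- The factor `2^{(k+1)s}`, which compensates `|x - y|^s` for `|x - y| ≥ 2^{-k-1}`. -/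
def scaleWeight (s : ℝ) (k : ℤ) : ℝ≥0∞ := ENNReal.ofReal ((2 : ℝ) ^ ((k + 1) * s))

theorem one_le_dist_mul_scaleWeight {s d : ℝ} (hs : 0 < s) {k : ℤ}
    (hd : (2 : ℝ) ^ (-k - 1) ≤ d) : 1 ≤ ENNReal.ofReal (d ^ s) * scaleWeight s k := by
  have hd0 : 0 < d := lt_of_lt_of_le (by positivity) hd
  rw [scaleWeight, ← ENNReal.ofReal_mul (by positivity), ENNReal.one_le_ofReal]
  have h1 : ((2 : ℝ) ^ (-k - 1)) ^ s * (2 : ℝ) ^ ((k + 1) * s) = 1 := by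
    rw [← Real.rpow_intCast, ← Real.rpow_mul two_pos.le, ← Real.rpow_add two_pos]
    push_cast
    ring_nf
    exact Real.rpow_zero 2
  refine h1.symm.trans_le ?_
  exact mul_le_mul_of_nonneg_right (Real.rpow_le_rpow (by positivity) hd hs.le) (by positivity)

/-- The function with `|v x - v y| ≤ w x + w y` for `|x - y| < 2^{-k}`: at coarse scales it is `|v|`
itself, at fine scales a multiple of the maximal oscillation. -/
def gradCore {n : ℕ} (s p : ℝ) (C : ℝ≥0∞) (S : Set (Rn n)) (v : Rn n → ℝ) (k : ℤ) (x : Rn n) :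
    ℝ≥0∞ :=
  if k ≤ 1 then ‖v x‖ₑ else C * maxOsc p ((2 : ℝ) ^ (-(s / 2))) S v ((2 : ℝ) ^ (1 - k)) x

theorem measurable_gradCore {n : ℕ} (s p : ℝ) (C : ℝ≥0∞) {S : Set (Rn n)} (hS : MeasurableSet S)
    {v : Rn n → ℝ} (hv : Measurable v) (k : ℤ) : Measurable (gradCore s p C S v k) := by
  unfold gradCore
  split_ifs
  · fun_prop
  · exact (measurable_maxOsc p _ hS hv _).const_mul _

/-- The exceptional set consists of the points of `S` at which `v` is not approximately
continuous. -/
theorem exists_isFracGradient_gradCore (n : ℕ) {s p cm : ℝ} (hs : 0 < s) (hp : 0 < p)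
    (hcm : 0 < cm) :
    ∃ C : ℝ≥0∞, C ≠ ∞ ∧ ∀ {S : Set (Rn n)} (_ : MeasurableSet S) (_ : MeasureDensity cm S)
      {v : Rn n → ℝ} (_ : Measurable v),
      IsFracGradient s S (fun x => (v x : EReal))
        fun k x => scaleWeight s k * gradCore s p C S v k x := by
  obtain ⟨l, hl0, hl, hl'⟩ := exists_chebyshev_level n hp hcm
  set ρ : ℝ := (2 : ℝ) ^ (-(s / 2))
  have hρ1 : ρ < 1 := Real.rpow_lt_one_of_one_lt_of_neg one_lt_two (by linarith)
  refine ⟨ENNReal.ofReal (l * (4 + 4 / (1 - ρ))), ENNReal.ofReal_ne_top, ?_⟩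
  intro S hS hd v hv
  set C := ENNReal.ofReal (l * (4 + 4 / (1 - ρ)))
  refine ⟨fun k => ((measurable_gradCore s p C hS hv k).const_mul _).aemeasurable,
    {x | x ∈ S ∧ ¬ ApproxContinuousAt S v x}, fun x hx => hx.1, ?_, ?_⟩
  · have := ae_approxContinuousAt hS hv
    rw [ae_iff] at this
    simpa only [Classical.not_imp] using this
  intro k x hx y hy hxy hxy'
  have hcore : ‖v x - v y‖ₑ ≤ gradCore s p C S v k x + gradCore s p C S v k y := by
    unfold gradCore
    split_ifs with hk
    · exact enorm_sub_le
    · have h2 : (2 : ℝ) ^ (1 - k) / 2 = (2 : ℝ) ^ (-k) := by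
        rw [sub_eq_add_neg, zpow_one_add₀ two_ne_zero, mul_div_cancel_left₀ _ two_ne_zero]
      rw [← mul_add]
      exact enorm_sub_le_maxOsc hp hv hd hl0 hl hl' (by positivity) hρ1 hx.1
        (by_contra fun h => hx.2 ⟨hx.1, h⟩) hy.1 (by_contra fun h => hy.2 ⟨hy.1, h⟩)
        (by positivity) (zpow_le_one_of_nonpos₀ one_le_two (by omega)) (by rw [h2]; exact hxy'.le)
  rw [absDiff_coe, ← mul_add, ← mul_assoc]
  exact hcore.trans (le_mul_of_one_le_left' (one_le_dist_mul_scaleWeight hs hxy))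

/-- The weights `2 ^ (k * s)` of the gradient and `2 ^ (i * s / 2)` of the maximal oscillation leave
the decay `2 ^ (-i * s / 2)` relative to the weights of the scale integral; one half of it is spent
on the `L^p` norm of the supremum, the other half on the Hardy inequality. -/
theorem exists_gradNorm_gradCore_le (n : ℕ) {s p : ℝ} {q C : ℝ≥0∞} (hs : 0 < s) (hp : 0 < p)
    (hq : 0 < q) (hC : C ≠ ∞) :
    ∃ K : ℝ≥0∞, K ≠ ∞ ∧ ∀ {S : Set (Rn n)} (_ : MeasurableSet S) {v : Rn n → ℝ}
      (_ : Measurable v),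
      gradNorm p q S (fun k x => scaleWeight s k * gradCore s p C S v k x) ≤
        K * normBhat s p q S fun x => (v x : EReal) := by
  set τ : ℝ≥0∞ := ENNReal.ofReal ((2 : ℝ) ^ (-(s / 4)))
  have hτ : τ < 1 :=
    ENNReal.ofReal_lt_one.2 (Real.rpow_lt_one_of_one_lt_of_neg one_lt_two (by linarith))
  obtain ⟨K₁, hK₁, h₁⟩ := exists_tsum_rpow_le_iSup hτ hp
  obtain ⟨K₂, hK₂, h₂⟩ := exists_seqNorm_iSup_le hτ hq
  obtain ⟨K₃, hK₃, h₃⟩ := exists_seqNorm_add_le q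
  obtain ⟨K₄, hK₄, h₄⟩ := exists_seqNorm_le_scaleNorm hq
  set L : ℝ≥0∞ := (2 ^ n) ^ (1 / p)
  have hL : L ≠ ∞ := by finiteness
  have hL0 : L ≠ 0 := (ENNReal.rpow_pos (by positivity) (by finiteness)).ne'
  set w : ℤ → ℝ≥0∞ := scaleWeight s
  have hw (k : ℤ) : w k ≠ ∞ := ENNReal.ofReal_ne_top
  have hw1 := hw 1
  have hw2 := hw 2
  set B : ℝ≥0∞ := C * K₁ * (2 * w 2)
  have hB : B ≠ ∞ := by finiteness
  refine ⟨K₂ * (K₃ * (w 1 + B * (L * K₄))), by finiteness, ?_⟩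
  intro S hS v hv
  set H : ℝ → ℝ≥0∞ := hatModulus p S fun x => (v x : EReal)
  set N : ℝ≥0∞ := normLp p S fun x => (v x : EReal)
  -- `b₂ m` is, up to constants, the scale term `t ^ (-s) * H t` at `t = 2 ^ (-m - 1)`. In `b` it is
  -- shifted by two, because the fine levels start at `k = 2` with radius `2⁻¹`; all the coarse
  -- levels `k ≤ 1` are dominated by the single entry at `1`.
  set b₂ : ℤ → ℝ≥0∞ := fun m => if 0 ≤ m then w (m - 1) * H ((2 : ℝ) ^ (-m - 1)) else 0
  set b : ℤ → ℝ≥0∞ := fun k => (if k = 1 then w 1 * N else 0) + B * b₂ (k + -2)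
  -- `2 ^ (3 * s)` times `2 ^ (-i * s / 2)` times the weight of the scale integral.
  have hw_fine (k : ℤ) (i : ℕ) : w k * ENNReal.ofReal ((2 : ℝ) ^ (-(s / 2)))⁻¹ ^ i =
      τ ^ i * τ ^ i * (w 2 * w (k + i + -2 - 1)) := by
    simp only [w, τ, scaleWeight]
    rw [← ENNReal.ofReal_pow (by positivity), ← ENNReal.ofReal_pow (by positivity),
      ← ENNReal.ofReal_mul (by positivity), ← ENNReal.ofReal_mul (by positivity),
      ← ENNReal.ofReal_mul (by positivity), ← ENNReal.ofReal_mul (by positivity),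
      ← Real.rpow_neg two_pos.le, ← Real.rpow_natCast, ← Real.rpow_natCast,
      ← Real.rpow_mul two_pos.le, ← Real.rpow_mul two_pos.le, ← Real.rpow_add two_pos,
      ← Real.rpow_add two_pos, ← Real.rpow_add two_pos, ← Real.rpow_add two_pos]
    congr 2
    push_cast
    ring
  have hw_coarse (k : ℤ) (i : ℕ) (hki : k + i = 1) : w k ≤ τ ^ i * w 1 := by
    simp only [w, τ, scaleWeight]
    rw [← ENNReal.ofReal_pow (by positivity), ← ENNReal.ofReal_mul (by positivity),
      ← Real.rpow_natCast, ← Real.rpow_mul two_pos.le, ← Real.rpow_add two_pos]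
    refine ENNReal.ofReal_le_ofReal (Real.rpow_le_rpow_of_exponent_le one_le_two ?_)
    have : (k : ℝ) = 1 - i := by
      have := congrArg (Int.cast : ℤ → ℝ) hki
      push_cast at this
      linarith
    rw [this]
    push_cast
    nlinarith [(Nat.cast_nonneg i : (0 : ℝ) ≤ i)]
  have hterm (k : ℤ) : (∫⁻ x in S, (w k * gradCore s p C S v k x) ^ p) ^ (1 / p) ≤
      ⨆ i : ℕ, τ ^ i * b (k + i) := by
    have hmul (f : Rn n → ℝ≥0∞) (c : ℝ≥0∞) (hc : c ≠ ∞) :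
        (∫⁻ x in S, (c * f x) ^ p) ^ (1 / p) = c * (∫⁻ x in S, f x ^ p) ^ (1 / p) := by
      simp_rw [ENNReal.mul_rpow_of_nonneg _ _ hp.le]
      rw [lintegral_const_mul' _ _ (by finiteness), ENNReal.mul_rpow_of_nonneg _ _ (by positivity),
        rpow_rpow_inv' hp]
    rw [hmul _ _ (hw k)]
    unfold gradCore
    split_ifs with hk
    · obtain ⟨i, hi⟩ := Int.le.dest hk
      refine le_iSup_of_le i ?_
      calc w k * (∫⁻ x in S, ‖v x‖ₑ ^ p) ^ (1 / p) = w k * N := by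
            simp only [N, normLp, Real.enorm_eq_ofReal_abs]
            rfl
        _ ≤ τ ^ i * (w 1 * N) := by
            rw [← mul_assoc]
            gcongr
            exact hw_coarse k i hi
        _ ≤ τ ^ i * b (k + i) := by
            gcongr
            simp only [b, hi, if_true]
            exact le_self_add
    · rw [hmul _ _ hC]
      calc _ ≤ w k * (C * (∑' i : ℕ, (ENNReal.ofReal ((2 : ℝ) ^ (-(s / 2)))⁻¹ ^ i *
              (2 * H ((2 : ℝ) ^ (1 - k) / 2 ^ i))) ^ p) ^ (1 / p)) := by
            gcongr
            exact lintegral_maxOsc_rpow_le hp hS hv _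
        _ = C * (∑' i : ℕ, (τ ^ i * τ ^ i * (2 * w 2 * b₂ (k + i + -2))) ^ p) ^ (1 / p) := by
            rw [mul_left_comm]
            congr 1
            rw [← rpow_rpow_inv' hp (w k), ← ENNReal.mul_rpow_of_nonneg _ _ (by positivity),
              ← ENNReal.tsum_mul_left]
            congr 1
            refine tsum_congr fun i => ?_
            rw [← ENNReal.mul_rpow_of_nonneg _ _ hp.le, ← mul_assoc, hw_fine]
            have hr : (2 : ℝ) ^ (1 - k) / 2 ^ i = (2 : ℝ) ^ (-(k + i + -2) - 1) := by
              rw [← zpow_natCast, ← zpow_sub₀ two_ne_zero]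
              congr 1
              ring
            simp only [b₂]
            rw [hr, if_pos (by omega)]
            congr 1
            ring
        _ ≤ C * (K₁ * ⨆ i : ℕ, τ ^ i * (2 * w 2 * b₂ (k + i + -2))) := by
            gcongr
            exact h₁ fun i => 2 * w 2 * b₂ (k + i + -2)
        _ ≤ _ := by
            rw [← mul_assoc, ENNReal.mul_iSup]
            refine iSup_mono fun i => ?_
            calc _ = τ ^ i * (B * b₂ (k + i + -2)) := by simp only [B]; ring
              _ ≤ _ := by
                gcongr
                exact le_add_self
  have hb₂ : seqNorm q b₂ ≤ L * K₄ * scaleNorm s q H := by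
    have h := h₄ s H (fun m => L⁻¹ * b₂ m) (fun m hm => by simp [b₂, hm.not_ge]) ?_
    · rw [seqNorm_const_mul q hq, ← ENNReal.div_eq_inv_mul] at h
      rw [mul_assoc]
      exact (ENNReal.div_le_iff' hL0 hL).1 h
    · intro m hm t ht
      have ht0 := pos_of_mem_dyadicIco ht
      rw [← ENNReal.div_eq_inv_mul, ENNReal.div_le_iff' hL0 hL]
      simp only [b₂, if_pos hm]
      calc w (m - 1) * H ((2 : ℝ) ^ (-m - 1)) ≤ ENNReal.ofReal (t ^ (-s)) * (L * H t) := by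
            refine mul_le_mul' (ENNReal.ofReal_le_ofReal ?_) (hatModulus_le_of_le hp S _ ht.1 ?_)
            · have : (2 : ℝ) ^ (((m - 1 : ℤ) + 1 : ℝ) * s) = ((2 : ℝ) ^ (-m)) ^ (-s) := by
                rw [← Real.rpow_intCast, ← Real.rpow_mul two_pos.le]
                congr 1
                push_cast
                ring
              rw [this]
              exact Real.rpow_le_rpow_of_nonpos ht0 ht.2.le (by linarith)
            · rw [zpow_sub_one₀ two_ne_zero]
              linarith [ht.2]
        _ = _ := mul_left_comm _ _ _
  calc _ ≤ seqNorm q (fun k => ⨆ i : ℕ, τ ^ i * b (k + i)) := seqNorm_mono hterm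
    _ ≤ K₂ * seqNorm q b := h₂ b
    _ ≤ K₂ * (K₃ * (w 1 * N + B * (L * K₄ * scaleNorm s q H))) := by
        gcongr
        refine (h₃ _ _).trans ?_
        rw [seqNorm_single hq, seqNorm_const_mul q hq, seqNorm_shift q b₂]
        gcongr
    _ ≤ K₂ * (K₃ * ((w 1 + B * (L * K₄)) * (N + scaleNorm s q H))) := by
        gcongr
        rw [add_mul, mul_assoc B]
        gcongr
        exacts [le_self_add, le_add_self]
    _ = _ := by rw [normBhat]; ring

/-! ### Reduction to real valued functions on Borel sets -/

/-- Passing to a Borel subset `S'` of full measure on which `u` agrees with a real valued Borel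
function. Finiteness of the `L^p` norm is what excludes infinite values on a set of positive
measure. -/
theorem exists_real_representative {n : ℕ} {p : ℝ} (hp : 0 < p) {S : Set (Rn n)}
    (hS : NullMeasurableSet S volume) {u : Rn n → EReal} (hu : LebesgueMeasurableOn S u)
    (hfin : normLp p S u ≠ ∞) :
    ∃ S' ⊆ S, MeasurableSet S' ∧ S' =ᵐ[volume] S ∧ ∃ v : Rn n → ℝ, Measurable v ∧
      ∀ x ∈ S', u x = v x := by
  have hu' : AEMeasurable u (volume.restrict S) := hu
  obtain ⟨w, hw, huw⟩ := hu
  have habs : Measurable fun x : EReal => x.abs ^ p := by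
    refine (EReal.measurable_of_measurable_real ?_).pow_const p
    simp only [EReal.abs_def]
    fun_prop
  have hint : ∫⁻ x in S, (u x).abs ^ p ≠ ∞ := by
    intro h
    rw [normLp, h, ENNReal.top_rpow_of_pos (by positivity)] at hfin
    exact hfin rfl
  have hae : ∀ᵐ x ∂volume.restrict S, u x = ((w x).toReal : EReal) := by
    filter_upwards [ae_lt_top' (habs.comp_aemeasurable hu') hint, huw] with x hx hxw
    rw [← hxw, EReal.coe_toReal] <;> rintro h <;> simp [h, hp] at hx
  rw [ae_restrict_iff'₀ hS] at hae
  obtain ⟨S', hS'S, hS', hS'ae⟩ := hS.exists_measurable_subset_ae_eq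
  obtain ⟨T, hTsub, hTm, hT0⟩ := exists_measurable_superset_of_null (ae_iff.1 hae)
  refine ⟨S' \ T, sdiff_subset.trans hS'S, hS'.diff hTm, ?_, fun x => (w x).toReal,
    hw.ereal_toReal, fun x hx => ?_⟩
  · exact (sdiff_null_ae_eq_self hT0).trans hS'ae
  · by_contra h
    exact hx.2 (hTsub fun H => h (H (hS'S hx.1)))

section Congr

variable {n : ℕ} {p : ℝ} {S S' : Set (Rn n)} {u u' : Rn n → EReal}

theorem normLp_congr (hS' : MeasurableSet S') (h : S' =ᵐ[volume] S) (hu : ∀ x ∈ S', u x = u' x) :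
    normLp p S u = normLp p S' u' := by
  unfold normLp
  rw [← setLIntegral_congr h, setLIntegral_congr_fun hS' fun x hx => by rw [hu x hx]]

theorem lintegral_shiftInter_congr (hS' : MeasurableSet S') (h : S' =ᵐ[volume] S)
    (hu : ∀ x ∈ S', u x = u' x) (y : Rn n) :
    ∫⁻ x in shiftInter S y, absDiff (u (x + y)) (u x) ^ p =
      ∫⁻ x in shiftInter S' y, absDiff (u' (x + y)) (u' x) ^ p := by
  have hae : shiftInter S' y =ᵐ[volume] shiftInter S y :=
    h.inter ((quasiMeasurePreserving_add_right volume y).preimage_ae_eq h)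
  rw [← setLIntegral_congr hae, setLIntegral_congr_fun (measurableSet_shiftInter hS' y)
    fun x hx => by rw [hu x hx.1, hu _ hx.2]]

theorem omega_congr (hS' : MeasurableSet S') (h : S' =ᵐ[volume] S) (hu : ∀ x ∈ S', u x = u' x) :
    omega p S u = omega p S' u' := by
  funext t
  simp only [omega, lintegral_shiftInter_congr hS' h hu]

theorem avgModulus_congr (hS' : MeasurableSet S') (h : S' =ᵐ[volume] S)
    (hu : ∀ x ∈ S', u x = u' x) : avgModulus p S u = avgModulus p S' u' := by
  funext t
  simp only [avgModulus, lintegral_shiftInter_congr hS' h hu]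

theorem hatModulus_congr (hS' : MeasurableSet S') (h : S' =ᵐ[volume] S)
    (hu : ∀ x ∈ S', u x = u' x) : hatModulus p S u = hatModulus p S' u' := by
  have hball (x : Rn n) (t : ℝ) (c : ℝ) :
      ∫⁻ y in Metric.ball x t ∩ S, absDiff (u y) (c : EReal) ^ p =
        ∫⁻ y in Metric.ball x t ∩ S', absDiff (u' y) (c : EReal) ^ p := by
    rw [← setLIntegral_congr ((ae_eq_refl (Metric.ball x t)).inter h),
      setLIntegral_congr_fun (measurableSet_ball.inter hS') fun y hy => by rw [hu y hy.2]]
  funext t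
  simp only [hatModulus, hball, setLIntegral_congr h]

/-- The null set `S \ S'` is absorbed into the exceptional set of the gradient. -/
theorem isFracGradient_congr {s : ℝ} (hsub : S' ⊆ S) (h : S' =ᵐ[volume] S)
    (hu : ∀ x ∈ S', u x = u' x) (g : ℤ → Rn n → ℝ≥0∞) :
    IsFracGradient s S u g ↔ IsFracGradient s S' u' g := by
  unfold IsFracGradient
  rw [Measure.restrict_congr_set h]
  refine and_congr_right fun _ => ⟨?_, ?_⟩
  · rintro ⟨E, hES, hE, H⟩
    refine ⟨E ∩ S', inter_subset_right, measure_mono_null inter_subset_left hE, ?_⟩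
    intro k x hx y hy
    rw [← hu x hx.1, ← hu y hy.1]
    exact H k x ⟨hsub hx.1, fun hE => hx.2 ⟨hE, hx.1⟩⟩ y ⟨hsub hy.1, fun hE => hy.2 ⟨hE, hy.1⟩⟩
  · rintro ⟨E, hES, hE, H⟩
    refine ⟨E ∪ S \ S', union_subset (hES.trans hsub) sdiff_subset,
      measure_union_null hE (ae_le_set.1 h.symm.le), ?_⟩
    intro k x hx y hy
    have aux {z : Rn n} (hz : z ∈ S \ (E ∪ S \ S')) : z ∈ S' \ E :=
      ⟨by_contra fun hz' => hz.2 (Or.inr ⟨hz.1, hz'⟩), fun hE => hz.2 (Or.inl hE)⟩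
    rw [hu x (aux hx).1, hu y (aux hy).1]
    exact H k x (aux hx) y (aux hy)

theorem measureDensity_congr {c : ℝ} (hsub : S' ⊆ S) (h : S' =ᵐ[volume] S)
    (hd : MeasureDensity c S) : MeasureDensity c S' := fun x hx r hr hr1 =>
  (hd x (hsub hx) r hr hr1).trans_eq (measure_congr (h.symm.inter (ae_eq_refl _)))

end Congr

/-! ### Comparison of the norms -/

section Norms

variable {n : ℕ} {s p : ℝ} {q : ℝ≥0∞} {S : Set (Rn n)} {u : Rn n → EReal}

theorem normBhat_le_normBavg (hp : 0 < p) (hS : NullMeasurableSet S volume)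
    (hu : LebesgueMeasurableOn S u) : normBhat s p q S u ≤ normBavg s p q S u := by
  rcases eq_or_ne (normLp p S u) ∞ with hfin | hfin
  · simp [normBavg, hfin]
  obtain ⟨S', -, hS', hae, v, hv, huv⟩ := exists_real_representative hp hS hu hfin
  rw [normBhat, normBavg, hatModulus_congr (u' := fun x => (v x : EReal)) hS' hae huv,
    avgModulus_congr (u' := fun x => (v x : EReal)) hS' hae huv]
  gcongr
  exact scaleNorm_mono fun t ht => hatModulus_le_avgModulus hp hS' hv ht.1

theorem normBavg_le_normB (hp : 0 < p) : normBavg s p q S u ≤ normB s p q S u :=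
  add_le_add le_rfl (scaleNorm_mono fun t _ => avgModulus_le_omega hp S u t)

theorem exists_one_le_and_le_ofReal {K : ℝ≥0∞} (hK : K ≠ ∞) :
    ∃ C : ℝ, 1 ≤ C ∧ K ≤ ENNReal.ofReal C := by
  refine ⟨K.toReal + 1, by linarith [K.toReal_nonneg], ?_⟩
  exact (ENNReal.ofReal_toReal hK).symm.trans_le (ENNReal.ofReal_le_ofReal (by linarith))

end Norms

theorem exists_normB_le_normN {s p : ℝ} {q : ℝ≥0∞} (hs : 0 < s) (hp : 0 < p) (hq : 0 < q) :
    ∃ C : ℝ, 1 ≤ C ∧ ∀ {n : ℕ} {S : Set (Rn n)} {u : Rn n → EReal}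
      (_ : NullMeasurableSet S volume) (_ : LebesgueMeasurableOn S u),
      normB s p q S u ≤ ENNReal.ofReal C * normN s p q S u := by
  obtain ⟨K, hK, h⟩ := exists_scaleNorm_omega_le_gradNorm hs hp hq
  obtain ⟨C, hC1, hKC⟩ := exists_one_le_and_le_ofReal hK
  have hC1' : 1 ≤ ENNReal.ofReal C := ENNReal.one_le_ofReal.2 hC1
  refine ⟨C, hC1, fun {n S u} hS hu => ?_⟩
  rcases eq_or_ne (normLp p S u) ∞ with hfin | hfin
  · rw [normN, hfin, top_add, ENNReal.mul_top (zero_lt_one.trans_le hC1').ne']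
    exact le_top
  obtain ⟨S', hsub, hS', hae, v, hv, huv⟩ := exists_real_representative hp hS hu hfin
  rw [normB, normN, mul_add]
  refine add_le_add (le_mul_of_one_le_left' hC1') ?_
  simp_rw [ENNReal.mul_iInf_of_ne (zero_lt_one.trans_le hC1').ne' ENNReal.ofReal_ne_top]
  refine le_iInf₂ fun g hg => ?_
  rw [omega_congr (u' := fun x => (v x : EReal)) hS' hae huv]
  rw [isFracGradient_congr (u' := fun x => (v x : EReal)) hsub hae huv] at hg
  refine (h hS' hg).trans (mul_le_mul' hKC ?_)
  simp only [gradNorm, setLIntegral_congr hae, le_refl]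

theorem exists_normN_le_normBhat (n : ℕ) {s p cm : ℝ} {q : ℝ≥0∞} (hs : 0 < s) (hp : 0 < p)
    (hq : 0 < q) (hcm : 0 < cm) :
    ∃ C : ℝ, 1 ≤ C ∧ ∀ {S : Set (Rn n)} {u : Rn n → EReal} (_ : NullMeasurableSet S volume)
      (_ : MeasureDensity cm S) (_ : LebesgueMeasurableOn S u),
      normN s p q S u ≤ ENNReal.ofReal C * normBhat s p q S u := by
  obtain ⟨c, hc, hgrad⟩ := exists_isFracGradient_gradCore n hs hp hcm
  obtain ⟨K, hK, hnorm⟩ := exists_gradNorm_gradCore_le n hs hp hq hc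
  obtain ⟨C, hC1, hKC⟩ :=
    exists_one_le_and_le_ofReal (ENNReal.add_ne_top.2 ⟨ENNReal.one_ne_top, hK⟩)
  have hC1' : 1 ≤ ENNReal.ofReal C := ENNReal.one_le_ofReal.2 hC1
  refine ⟨C, hC1, fun {S u} hS hd hu => ?_⟩
  rcases eq_or_ne (normLp p S u) ∞ with hfin | hfin
  · rw [normBhat, hfin, top_add, ENNReal.mul_top (zero_lt_one.trans_le hC1').ne']
    exact le_top
  obtain ⟨S', hsub, hS', hae, v, hv, huv⟩ := exists_real_representative hp hS hu hfin
  have hg := hgrad hS' (measureDensity_congr hsub hae hd) hv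
  have hbound := hnorm hS' hv
  have heq : normBhat s p q S u = normBhat s p q S' fun x => (v x : EReal) := by
    rw [normBhat, normBhat, hatModulus_congr hS' hae huv, normLp_congr hS' hae huv]
  rw [← isFracGradient_congr hsub hae huv] at hg
  rw [← heq] at hbound
  simp only [gradNorm, setLIntegral_congr hae] at hbound
  calc normN s p q S u ≤ normBhat s p q S u + K * normBhat s p q S u :=
        add_le_add le_self_add ((iInf₂_le _ hg).trans hbound)
    _ = (1 + K) * normBhat s p q S u := by ring
    _ ≤ _ := by gcongr

end BesovSubset

end

theorem mainTheorem8 (n : ℕ) (s p : ℝ) (q : ENNReal)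
    (hs0 : 0 < s) (hs1 : s < 1) (hp : 0 < p) (hq : 0 < q) :
    (∃ C : ℝ, 0 < C ∧ ∀ S : Set (BesovSubset.Rn n),
      MeasureTheory.NullMeasurableSet S MeasureTheory.volume →
        (BesovSubset.spaceN s p q S ⊆ BesovSubset.spaceB s p q S ∧
          BesovSubset.spaceB s p q S ⊆ BesovSubset.spaceBavg s p q S ∧
          BesovSubset.spaceBavg s p q S ⊆ BesovSubset.spaceBhat s p q S) ∧
        ∀ u : BesovSubset.Rn n → EReal, BesovSubset.LebesgueMeasurableOn S u →
          BesovSubset.normBhat s p q S u ≤ BesovSubset.normBavg s p q S u ∧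
          BesovSubset.normBavg s p q S u ≤ BesovSubset.normB s p q S u ∧
          BesovSubset.normB s p q S u ≤ ENNReal.ofReal C * BesovSubset.normN s p q S u) ∧
    (∀ cm : ℝ, 0 < cm → ∃ C : ℝ, 0 < C ∧ ∀ S : Set (BesovSubset.Rn n),
      MeasureTheory.NullMeasurableSet S MeasureTheory.volume →
      BesovSubset.MeasureDensity cm S →
        (BesovSubset.spaceN s p q S = BesovSubset.spaceB s p q S ∧
          BesovSubset.spaceB s p q S = BesovSubset.spaceBavg s p q S ∧
          BesovSubset.spaceBavg s p q S = BesovSubset.spaceBhat s p q S) ∧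
        ∀ u : BesovSubset.Rn n → EReal, BesovSubset.LebesgueMeasurableOn S u →
          BesovSubset.normBhat s p q S u ≤ BesovSubset.normBavg s p q S u ∧
          BesovSubset.normBavg s p q S u ≤ BesovSubset.normB s p q S u ∧
          BesovSubset.normB s p q S u ≤ ENNReal.ofReal C * BesovSubset.normN s p q S u ∧
          BesovSubset.normN s p q S u ≤ ENNReal.ofReal C * BesovSubset.normBhat s p q S u) := by
  obtain ⟨C₁, hC₁, h₁⟩ := BesovSubset.exists_normB_le_normN hs0 hp hq
  have hNB {S : Set (BesovSubset.Rn n)} (hS : NullMeasurableSet S volume) :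
      BesovSubset.spaceN s p q S ⊆ BesovSubset.spaceB s p q S := fun u hu =>
    ⟨hu.1, (h₁ hS hu.1).trans_lt (ENNReal.mul_lt_top ENNReal.ofReal_lt_top hu.2)⟩
  have hBA {S : Set (BesovSubset.Rn n)} :
      BesovSubset.spaceB s p q S ⊆ BesovSubset.spaceBavg s p q S := fun u hu =>
    ⟨hu.1, (BesovSubset.normBavg_le_normB hp).trans_lt hu.2⟩
  have hAH {S : Set (BesovSubset.Rn n)} (hS : NullMeasurableSet S volume) :
      BesovSubset.spaceBavg s p q S ⊆ BesovSubset.spaceBhat s p q S := fun u hu =>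
    ⟨hu.1, (BesovSubset.normBhat_le_normBavg hp hS hu.1).trans_lt hu.2⟩
  refine ⟨⟨C₁, by linarith, fun S hS => ⟨⟨hNB hS, hBA, hAH hS⟩, fun u hu =>
    ⟨BesovSubset.normBhat_le_normBavg hp hS hu, BesovSubset.normBavg_le_normB hp, h₁ hS hu⟩⟩⟩,
    fun cm hcm => ?_⟩
  obtain ⟨C₂, hC₂, h₂⟩ := BesovSubset.exists_normN_le_normBhat n hs0 hp hq hcm
  refine ⟨max C₁ C₂, by positivity, fun S hS hd => ?_⟩
  have hHN : BesovSubset.spaceBhat s p q S ⊆ BesovSubset.spaceN s p q S := fun u hu =>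
    ⟨hu.1, (h₂ hS hd hu.1).trans_lt (ENNReal.mul_lt_top ENNReal.ofReal_lt_top hu.2)⟩
  refine ⟨⟨(hNB hS).antisymm ((hBA.trans (hAH hS)).trans hHN),
    hBA.antisymm (((hAH hS).trans hHN).trans (hNB hS)),
    (hAH hS).antisymm ((hHN.trans (hNB hS)).trans hBA)⟩, fun u hu =>
    ⟨BesovSubset.normBhat_le_normBavg hp hS hu, BesovSubset.normBavg_le_normB hp, ?_, ?_⟩⟩
  · refine (h₁ hS hu).trans (mul_le_mul_left (ENNReal.ofReal_le_ofReal (le_max_left _ _)) _)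
  · refine (h₂ hS hd hu).trans (mul_le_mul_left (ENNReal.ofReal_le_ofReal (le_max_right _ _)) _)
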